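/- **Setting.** Let $n\ge 1$, $\varepsilon_0\ge 0$, and let $\mathcal A_0:\mathcal Z\to\widetilde{\mathcal Z}$ be an $\varepsilon_0$-DP local randomizer, i.e. $\mathbb P[\mathcal A_0(z)\in E]\le e^{\varepsilon_0}\,\mathbb P[\mathcal A_0(z')\in E]$ for all $z,z'\in\mathcal Z$ and all events $E$. Let $\mathcal A(z_1,\dots,z_n)=(\mathcal A_0(z_1),\dots,\mathcal A_0(z_n))$ with independent randomness, and let $\mathcal A_{\mathrm{Shuffle}}$ apply a uniformly random permutation to the $n$ entries. For probability distributions $P,Q$ on the same space, the trade-off function is $T(P,Q)(\alpha)=\inf_\phi\{1-\mathbb E_Q[\phi]:\mathbb E_P[\phi]\le\alpha\}$ for $\alpha\in[0,1]$, the infimum being over all measurable $\phi$ with values in $[0,1]$. A mechanism $M$ is $f$-DP if $T(M(\mathcal D_0),M(\mathcal D_1))\ge f$ on $[0,1]$ for all datasets $\mathcal D_0,\mathcal D_1$ of size $n$ that differ in at most one record. For a trade-off function $f$ on $[0,1]$ let $\mathcal C(f)=\min\{f,f^{-1}\}^{**}$ be its symmetrization, where $f^{-1}(y)=\inf\{x\in[0,1]:f(x)\le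 y\}$, $g^*(y)=\sup_x\{xy-g(x)\}$ is the convex conjugate, and functions on $[0,1]$ are taken to be $+\infty$ outside $[0,1]$. Put $w=\frac1{1+e^{\varepsilon_0}}$, $\mathrm{Id}(x)=1-x$, let $w_i^0=\mathbb P[C=i]$ for $C\sim\mathrm{Binom}\big(n-1,\frac{2}{e^{\varepsilon_0}+1}\big)$, and let $F_i$ be the distribution function of $\mathrm{Binom}(i,1/2)$. Let $F_i^{-1}(p)=\min\{k\in\mathbb Z: k\ge -1,\ F_i(k)\ge p\}$, so that $F_i^{-1}(F_i(k))=k$ for $k\in\{-1,0,\dots,i\}$. For $t\ge0$ put $$\alpha_i(t)=F_i\Big(i-\frac{i+1}{t+1}\Big),\qquad \alpha(t)=\sum_{i=0}^{n-1}w_i^0\,\alpha_i(t).$$ **Theorem 1.** All $\alpha(t)$, $t\ge 0$, lie in $[0,1]$, and there are only finitely many distinct values among them. There is a piecewise linear function $f_{\mathrm{Shuffle}}$ on $[0,1]$ whose knots are the points $\alpha(t)$, $t\ge0$ (among them $\alpha(0)=0$), and the right end point $1$ (the limiting knot $\alpha(\infty)$), with values $$f_{\mathrm{Shuffle}}(\alpha(t))=2w\cdot\mathrm{Id}(\alpha(t))+(1-2w)\sum_{i=0}^{n-1}w_i^0\Big\{1-F_i\big[F_i^{-1}(\alpha_i(t))+1\big]\Big\}\quad(t\ge0),\qquad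 f_{\mathrm{Shuffle}}(1)=0,$$ that is affine between consecutive knots; and the shuffled mechanism $\mathcal A_{\mathrm{Shuffle}}\circ\mathcal A$ is $\mathcal C(f_{\mathrm{Shuffle}})$-DP. -/

import Mathlib

open MeasureTheory ProbabilityTheory Set
open scoped ENNReal NNReal

noncomputable section

namespace ShuffleDP

/-! ### Trade-off functions and differential privacy -/

/-- The trade-off function `T(P, Q)`: the minimal type II error `1 - E_Q[φ]` over all (randomized)
rejection rules `φ` with values in `[0, 1]` and type I error `E_P[φ]` at most `α`. -/
def tradeOff {S : Type*} [MeasurableSpace S] (P Q : ProbabilityMeasure S) (α : ℝ) : ℝ :=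
  sInf {β : ℝ | ∃ φ : S → ℝ, Measurable φ ∧ (∀ s, φ s ∈ Icc (0 : ℝ) 1) ∧
    ∫ s, φ s ∂(P : Measure S) ≤ α ∧ β = 1 - ∫ s, φ s ∂(Q : Measure S)}

/-- Two datasets of size `n` are neighboring if they differ in at most one record. -/
def Neighboring {Z : Type*} {n : ℕ} (D₀ D₁ : Fin n → Z) : Prop :=
  ∃ i, ∀ j, j ≠ i → D₀ j = D₁ j

/-- A mechanism `M` is `f`-DP if `T(M(D₀), M(D₁)) ≥ f` on `[0, 1]` for all neighboring datasets. -/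
def IsFDP {Z S : Type*} [MeasurableSpace S] {n : ℕ}
    (M : (Fin n → Z) → ProbabilityMeasure S) (f : ℝ → ℝ) : Prop :=
  ∀ D₀ D₁ : Fin n → Z, Neighboring D₀ D₁ →
    ∀ α ∈ Icc (0 : ℝ) 1, f α ≤ tradeOff (M D₀) (M D₁) α

/-- A local randomizer is `ε`-DP if for any two records `z, z'` and any event `E`,
`P[A₀(z) ∈ E] ≤ e^ε P[A₀(z') ∈ E]`. -/
def IsLocalDP {Z W : Type*} [MeasurableSpace W]
    (A₀ : Z → ProbabilityMeasure W) (ε : ℝ) : Prop :=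
  ∀ z z' : Z, ∀ E : Set W, MeasurableSet E →
    (A₀ z : Measure W) E ≤ ENNReal.ofReal (Real.exp ε) * (A₀ z' : Measure W) E

/-! ### The shuffled mechanism -/

/-- The mechanism privatizing the records independently: the law of `(A₀(z₁), …, A₀(zₙ))`. -/
def localMechanism {Z W : Type*} [MeasurableSpace W] {n : ℕ}
    (A₀ : Z → ProbabilityMeasure W) (D : Fin n → Z) : ProbabilityMeasure (Fin n → W) :=
  ⟨Measure.pi fun i => (A₀ (D i) : Measure W), inferInstance⟩

/-- The shuffler: the law of `y ∘ π` for a uniformly random permutation `π` of the `n` positions. -/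
def shuffler (W : Type*) [MeasurableSpace W] (n : ℕ) : Kernel (Fin n → W) (Fin n → W) where
  toFun y := (Fintype.card (Equiv.Perm (Fin n)) : ℝ≥0∞)⁻¹ •
    ∑ π : Equiv.Perm (Fin n), Measure.dirac (y ∘ π)
  measurable' := by
    refine Measure.measurable_of_measurable_coe _ fun s hs => ?_
    simp only [Measure.smul_apply, Measure.finsetSum_apply, smul_eq_mul]
    refine Measurable.const_mul (Finset.measurable_fun_sum _ fun π _ => ?_) _
    refine (Measure.measurable_coe hs).comp (Measure.measurable_dirac.comp ?_)
    exact measurable_pi_lambda _ fun i => measurable_pi_apply (π i)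

instance (W : Type*) [MeasurableSpace W] (n : ℕ) : IsMarkovKernel (shuffler W n) where
  isProbabilityMeasure y := ⟨by
    have h : (Fintype.card (Equiv.Perm (Fin n)) : ℝ≥0∞) ≠ 0 := by
      exact_mod_cast Fintype.card_ne_zero
    simp only [shuffler, Kernel.coe_mk, Measure.smul_apply, Measure.finsetSum_apply,
      measure_univ, Finset.sum_const, Finset.card_univ, smul_eq_mul, nsmul_eq_mul, mul_one]
    exact ENNReal.inv_mul_cancel h (ENNReal.natCast_ne_top _)⟩

/-- The shuffled mechanism: apply the local randomizer to every record, then shuffle. -/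
def shuffledMechanism {Z W : Type*} [MeasurableSpace W] {n : ℕ}
    (A₀ : Z → ProbabilityMeasure W) (D : Fin n → Z) : ProbabilityMeasure (Fin n → W) :=
  ⟨(localMechanism A₀ D : Measure (Fin n → W)).bind (shuffler W n), inferInstance⟩

/-! ### Symmetrization of trade-off functions -/

/-- The convex conjugate `y ↦ sup_{x ∈ s} (x y - g(x))` of a function `g` on a set `s ⊆ ℝ`. -/
def conjOn (s : Set ℝ) (g : ℝ → ℝ) (y : ℝ) : ℝ :=
  ⨆ x : s, ((x : ℝ) * y - g x)

/-- The left inverse of a non-increasing function `f` on `[0, 1]`: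
`f⁻¹(y) = inf {x ∈ [0, 1] : f x ≤ y}`. -/
def leftInv (f : ℝ → ℝ) (y : ℝ) : ℝ :=
  sInf {x : ℝ | x ∈ Icc (0 : ℝ) 1 ∧ f x ≤ y}

/-- The symmetrization `C(f) = min{f, f⁻¹}**` of a trade-off function `f`. Trade-off functions live
on `[0, 1]`, so the first conjugate is a supremum over `[0, 1]` (that is, the function is `+∞`
outside); the result of it is a function on all of `ℝ`. -/
def symmetrization (f : ℝ → ℝ) : ℝ → ℝ :=
  conjOn univ (conjOn (Icc 0 1) fun x => min (f x) (leftInv f x))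

/-! ### The trade-off function `f_Shuffle` -/

/-- The success probability `1/2`. -/
def half : unitInterval := ⟨1 / 2, by norm_num, by norm_num⟩

/-- The success probability `2 / (e^ε₀ + 1)`. -/
def cloneProb (ε₀ : ℝ≥0) : unitInterval :=
  ⟨2 / (Real.exp ε₀ + 1), by positivity, by
    have h : 1 ≤ Real.exp ε₀ := Real.one_le_exp ε₀.2
    rw [div_le_one (by positivity)]
    linarith⟩

/-- The distribution function `F_i` of `Binom(i, 1/2)`. -/
def F (i : ℕ) (x : ℝ) : ℝ :=
  cdf ((binomial i half).map (Nat.cast : ℕ → ℝ)) x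

/-- The inverse of `F_i` on its range: `F_i⁻¹(p)` is the least integer `k ≥ -1` with `F_i(k) ≥ p`.
As `F_i` is strictly increasing on `{-1, 0, …, i}`, we have `F_i⁻¹(F_i(k)) = k` for all `k` in this
set; in particular `F_i⁻¹(0) = -1`. -/
def Finv (i : ℕ) (p : ℝ) : ℤ :=
  sInf {k : ℤ | -1 ≤ k ∧ p ≤ F i k}

/-- The weight `w_i⁰ = P[C = i]` for `C ∼ Binom(n - 1, 2 / (e^ε₀ + 1))`. -/
def w₀ (n : ℕ) (ε₀ : ℝ≥0) (i : ℕ) : ℝ :=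
  (binomial (n - 1) (cloneProb ε₀)).real {i}

/-- `α_i(t) = F_i(i - (i + 1) / (t + 1))`. -/
def αi (i : ℕ) (t : ℝ) : ℝ :=
  F i (i - (i + 1) / (t + 1))

/-- The knot `α(t) = ∑ w_i⁰ α_i(t)`. -/
def knot (n : ℕ) (ε₀ : ℝ≥0) (t : ℝ) : ℝ :=
  ∑ i ∈ Finset.range n, w₀ n ε₀ i * αi i t

/-- The weight `w = 1 / (1 + e^ε₀)`. -/
def w (ε₀ : ℝ≥0) : ℝ := 1 / (1 + Real.exp ε₀)

/-- The identity trade-off function `Id(x) = 1 - x`. -/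
def IdTradeOff (x : ℝ) : ℝ := 1 - x

/-- The prescribed value at the knot `α(t)`:
`2 w Id(α(t)) + (1 - 2 w) ∑ w_i⁰ {1 - F_i[F_i⁻¹(α_i(t)) + 1]}`. -/
def knotValue (n : ℕ) (ε₀ : ℝ≥0) (t : ℝ) : ℝ :=
  2 * w ε₀ * IdTradeOff (knot n ε₀ t) +
    (1 - 2 * w ε₀) *
      ∑ i ∈ Finset.range n, w₀ n ε₀ i * (1 - F i ((Finv i (αi i t) : ℝ) + 1))

/-- The set of all knots: the points `α(t)`, `t ≥ 0`, and the right end point `1 = α(∞)`. -/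
def knots (n : ℕ) (ε₀ : ℝ≥0) : Set ℝ :=
  insert 1 (knot n ε₀ '' Ici 0)

/-- The ordinate above a knot `a`: the prescribed value if `a = α(t)` with `t ≥ 0`, and `0` for the
right end point `a = 1`. -/
def ordinate (n : ℕ) (ε₀ : ℝ≥0) (a : ℝ) : ℝ :=
  open Classical in
  if h : ∃ t, 0 ≤ t ∧ knot n ε₀ t = a then knotValue n ε₀ h.choose else 0

/-- Linear interpolation of the ordinates `v` between consecutive points of the set `K`. -/
def interpolate (K : Set ℝ) (v : ℝ → ℝ) (x : ℝ) : ℝ :=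
  let a := sSup (K ∩ Iic x)
  let b := sInf (K ∩ Ici x)
  v a + (x - a) / (b - a) * (v b - v a)

/-- The function `f_Shuffle`: the piecewise linear function on `[0, 1]` through the prescribed
points. -/
def fShuffle (n : ℕ) (ε₀ : ℝ≥0) : ℝ → ℝ :=
  interpolate (knots n ε₀) (ordinate n ε₀)

/-- `f` is a piecewise linear function on `[0, 1]` with knots in `K`: the set `K` is finite,
it contains the end points, and `f` is affine on every interval without a knot in its interior. -/
def IsPiecewiseLinear (f : ℝ → ℝ) (K : Set ℝ) : Prop :=
  K.Finite ∧ K ⊆ Icc 0 1 ∧ 0 ∈ K ∧ 1 ∈ K ∧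
    ∀ a ∈ Icc (0 : ℝ) 1, ∀ b ∈ Icc (0 : ℝ) 1, a < b → Disjoint K (Ioo a b) →
      ∀ x ∈ Icc a b, f x = f a + (x - a) / (b - a) * (f b - f a)

end ShuffleDP

end

namespace ShuffleDP

/-! ### Random walks with steps `a`, `-b` and `0` as operators on functions -/

/-! `symmetrization` is a supremum of affine functions of `α`, one for each slope `y`, so it
suffices to bound a linear combination of the two errors of an arbitrary test `φ`. For `y ≤ -1` and
`lam = -y`, this follows once `E_{D₁}[φ] - lam * E_{D₀}[φ]` is at most `1 - (f_Shuffle + lam * α)`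
at some knot `α` (`exists_knot_le`). Slopes in `(-1, 0)` reduce to the same estimate by exchanging
the datasets and passing to `1 - φ`, which is where the inverse in the symmetrization is used.
Slopes `y ≥ 0` are harmless because `f_Shuffle(1) = 0`.

For the estimate, let `P₀`, `P₁` be the laws of the differing record and `e = exp ε₀ > 1`. By
`exists_clone_decomposition`, `P₁ - lam P₀ = a κp - b κm` with `a = e - 1`, `b = lam (e + 1) - 2`,
and `κp + κm` lies below the law of every privatized record. Hence each record can be labelled as a
clone of `κp`, a clone of `κm`, or a remainder. Shuffling leaves only symmetric tests, and these
cannot see which clone sits at the special position. Averaging over the clones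
(`sum_mul_le_of_swap_invariant`) bounds the advantage by `E[max(0, S)] / n`, where `S` is a sum of
`n` independent steps `a`, `-b`, `0` whose nonzero values have the masses of `κp`, `κm` as
probabilities.

Both masses are at most `w = 1 / (1 + e)`, and raising both to `w` keeps the mean, so by convexity
it can only increase the bound (`step_pow_le_step_pow`). For the extremal walk, `E[S; S ≥ 0] = n
E[X₁; S ≥ 0]` (`step_pow_id_mul`). Conditioning on the number of nonzero steps among the other `n -
1` produces the weights `w_i⁰` and the functions `F_i`; the result is exactly the required
expression at the knot with parameter `t = a / b` (`drift_step_pow_eq`, `one_sub_knotValue`). -/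

/-- Translation of a function: `g ↦ g (· + c)`. -/
def shift (c : ℝ) : Module.End ℝ (ℝ → ℝ) := LinearMap.funLeft ℝ ℝ (· + c)

lemma shift_apply (c : ℝ) (g : ℝ → ℝ) (s : ℝ) : shift c g s = g (s + c) := rfl

lemma shift_mul (c d : ℝ) : shift c * shift d = shift (c + d) := by
  ext g s
  simp only [Module.End.mul_apply, shift_apply, add_assoc]

lemma shift_zero : shift 0 = 1 := by
  ext g s
  simp [shift_apply]

lemma shift_pow (c : ℝ) (k : ℕ) : shift c ^ k = shift (k * c) := by
  induction k with
  | zero => simp [shift_zero]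
  | succ k ih => rw [pow_succ, ih, shift_mul]; push_cast; ring_nf

lemma shift_commute (c d : ℝ) : Commute (shift c) (shift d) := by
  rw [Commute, SemiconjBy, shift_mul, shift_mul, add_comm]

/-- One step of a random walk: `+a` with probability `p`, `-b` with probability `q`, and `0`
otherwise. -/
noncomputable def step (a b p q : ℝ) : Module.End ℝ (ℝ → ℝ) :=
  (1 - p - q) • 1 + p • shift a + q • shift (-b)

/-- The drift operator of the random walk. -/
noncomputable def drift (a b p q : ℝ) : Module.End ℝ (ℝ → ℝ) :=
  (p * a) • shift a - (q * b) • shift (-b)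

/-- Multiplication of a function by the identity. -/
def mulId : Module.End ℝ (ℝ → ℝ) where
  toFun g s := s * g s
  map_add' g h := by ext s; simp [mul_add]
  map_smul' c g := by ext s; simp [mul_left_comm]

lemma step_apply (a b p q : ℝ) (g : ℝ → ℝ) (s : ℝ) :
    step a b p q g s = (1 - p - q) * g s + p * g (s + a) + q * g (s - b) := by
  simp [step, shift_apply, sub_eq_add_neg]

lemma drift_apply (a b p q : ℝ) (g : ℝ → ℝ) (s : ℝ) :
    drift a b p q g s = p * a * g (s + a) - q * b * g (s - b) := by
  simp [drift, shift_apply, sub_eq_add_neg]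

/-- The drift is the commutator of the step with multiplication by the position: moving by `c` turns
the factor `s` into `s + c`. -/
lemma step_mul_mulId (a b p q : ℝ) :
    step a b p q * mulId = mulId * step a b p q + drift a b p q := by
  ext g s
  simp only [Module.End.mul_apply, LinearMap.add_apply, Pi.add_apply, step_apply, drift_apply,
    mulId, LinearMap.coe_mk, AddHom.coe_mk]
  ring

lemma drift_commute_step (a b p q : ℝ) : Commute (drift a b p q) (step a b p q) := by
  ext g s
  simp only [Module.End.mul_apply, step_apply, drift_apply]
  ring_nf

/-- Leibniz rule for this commutator; the `n + 1` terms coincide because the drift commutes with the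
step. -/
lemma step_pow_mul_mulId (a b p q : ℝ) (n : ℕ) :
    step a b p q ^ (n + 1) * mulId =
      mulId * step a b p q ^ (n + 1) + (n + 1 : ℝ) • (drift a b p q * step a b p q ^ n) := by
  induction n with
  | zero => simp [step_mul_mulId]
  | succ n ih =>
    have h := (drift_commute_step a b p q).eq
    rw [pow_succ', mul_assoc, ih, mul_add, ← mul_assoc, step_mul_mulId, mul_smul_comm, ← mul_assoc,
      ← h, add_mul, mul_assoc, mul_assoc, ← pow_succ', ← pow_succ', Nat.cast_succ,
      add_smul (n + 1 : ℝ) 1, one_smul]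
    abel

/-- `E[S_n g(S_n)] = n E[X_1 g(S_n)]` for a random walk `S_n = X_1 + ⋯ + X_n` started at `0`. -/
lemma step_pow_id_mul (a b p q : ℝ) (n : ℕ) (g : ℝ → ℝ) :
    (step a b p q ^ (n + 1)) (fun s => s * g s) 0 =
      (n + 1) * drift a b p q ((step a b p q ^ n) g) 0 := by
  have h := congrFun (congrArg (fun T : Module.End ℝ (ℝ → ℝ) => T g)
    (step_pow_mul_mulId a b p q n)) 0
  simpa [mulId] using h

lemma sum_prod_eq_step_pow {a b p q : ℝ} {z π : Fin 3 → ℝ} (hz : z = ![0, a, -b])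
    (hπ : π = ![1 - p - q, p, q]) (g : ℝ → ℝ) (n : ℕ) (s : ℝ) :
    ∑ ℓ : Fin n → Fin 3, (∏ j, π (ℓ j)) * g (s + ∑ j, z (ℓ j)) = (step a b p q ^ n) g s := by
  induction n generalizing s with
  | zero => simp
  | succ n ih =>
    rw [← (Fin.consEquiv fun _ => Fin 3).sum_comp, Fintype.sum_prod_type]
    simp only [Fin.consEquiv_apply, Fin.prod_univ_succ, Fin.sum_univ_succ, Fin.cons_zero,
      Fin.cons_succ, mul_assoc, ← add_assoc, ← Finset.mul_sum]
    simp only [ih]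
    rw [pow_succ', Module.End.mul_apply, step_apply]
    simp [hz, hπ, sub_eq_add_neg]

lemma step_mono {a b p q : ℝ} (hp : 0 ≤ p) (hq : 0 ≤ q) (hpq : p + q ≤ 1) {g h : ℝ → ℝ}
    (hgh : g ≤ h) : step a b p q g ≤ step a b p q h := fun s => by
  rw [step_apply, step_apply]
  have := mul_le_mul_of_nonneg_left (hgh s) (by linarith : 0 ≤ 1 - p - q)
  have := mul_le_mul_of_nonneg_left (hgh (s + a)) hp
  have := mul_le_mul_of_nonneg_left (hgh (s - b)) hq
  linarith

lemma convexOn_step {a b p q : ℝ} (hp : 0 ≤ p) (hq : 0 ≤ q) (hpq : p + q ≤ 1) {g : ℝ → ℝ}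
    (hg : ConvexOn ℝ univ g) : ConvexOn ℝ univ (step a b p q g) := by
  have h : step a b p q g =
      (1 - p - q) • g + p • (fun s => g (a + s)) + q • (fun s => g (-b + s)) := by
    ext s
    simp only [step_apply, Pi.add_apply, Pi.smul_apply, smul_eq_mul]
    ring_nf
  rw [h]
  refine ((hg.smul (by linarith)).add (ConvexOn.smul hp ?_)).add (ConvexOn.smul hq ?_)
  · simpa [Function.comp_def] using hg.translate_right a
  · simpa [Function.comp_def] using hg.translate_right (-b)

lemma convexOn_step_pow {a b p q : ℝ} (hp : 0 ≤ p) (hq : 0 ≤ q) (hpq : p + q ≤ 1) (n : ℕ)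
    {g : ℝ → ℝ} (hg : ConvexOn ℝ univ g) : ConvexOn ℝ univ ((step a b p q ^ n) g) := by
  induction n with
  | zero => simpa
  | succ n ih =>
    rw [pow_succ', Module.End.mul_apply]
    exact convexOn_step hp hq hpq ih

/-- A two-point mean-preserving spread around `s` increases the value of a convex function. -/
lemma add_mul_le_of_convexOn {g : ℝ → ℝ} (hg : ConvexOn ℝ univ g) {a b u v : ℝ} (hu : 0 ≤ u)
    (hv : 0 ≤ v) (h : u * a = v * b) (s : ℝ) :
    (u + v) * g s ≤ u * g (s + a) + v * g (s - b) := by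
  rcases (add_nonneg hu hv).eq_or_lt with h0 | h0
  · have hu0 : u = 0 := by linarith
    have hv0 : v = 0 := by linarith
    simp [hu0, hv0]
  · have := hg.2 (mem_univ (s + a)) (mem_univ (s - b)) (div_nonneg hu h0.le)
      (div_nonneg hv h0.le) (by field_simp)
    simp only [smul_eq_mul] at this
    have e : u / (u + v) * (s + a) + v / (u + v) * (s - b) = s := by
      field_simp
      linear_combination h
    rw [e, ← mul_le_mul_iff_right₀ h0] at this
    refine this.trans_eq ?_
    field_simp

/-- The added mass `p' - p`, `q' - q` is moved from the zero step to a mean-zero two-point spread,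
so Jensen's inequality applies. -/
lemma step_le_step {a b p q p' q' : ℝ} (hp : p ≤ p') (hq : q ≤ q')
    (h : (p' - p) * a = (q' - q) * b) {g : ℝ → ℝ} (hg : ConvexOn ℝ univ g) :
    step a b p q g ≤ step a b p' q' g := fun s => by
  rw [step_apply, step_apply]
  linarith [add_mul_le_of_convexOn hg (sub_nonneg.2 hp) (sub_nonneg.2 hq) h s]

/-- Increasing the probabilities of both nonzero steps without changing the mean increases
expectations of convex functions. -/
lemma step_pow_le_step_pow {a b p q p' q' : ℝ} (hp0 : 0 ≤ p) (hq0 : 0 ≤ q) (hp : p ≤ p')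
    (hq : q ≤ q') (hpq : p' + q' ≤ 1) (h : (p' - p) * a = (q' - q) * b) {g : ℝ → ℝ}
    (hg : ConvexOn ℝ univ g) (n : ℕ) : (step a b p q ^ n) g ≤ (step a b p' q' ^ n) g := by
  induction n with
  | zero => simp
  | succ n ih =>
    rw [pow_succ', pow_succ', Module.End.mul_apply, Module.End.mul_apply]
    exact (step_mono hp0 hq0 (by linarith) ih).trans (step_le_step hp hq h
      (convexOn_step_pow (hp0.trans hp) (hq0.trans hq) hpq n hg))

/-- The law of the lazy walk as a mixture: `i ∼ Binom(m, 2 w)` nonzero steps, of which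
`k ∼ Binom(i, 1/2)` are equal to `-b`. -/
lemma step_pow_apply_eq_sum (a b w : ℝ) (m : ℕ) (g : ℝ → ℝ) (s : ℝ) :
    (step a b w w ^ m) g s =
      ∑ i ∈ Finset.range (m + 1), (m.choose i * (2 * w) ^ i * (1 - 2 * w) ^ (m - i)) *
        ∑ k ∈ Finset.range (i + 1), (i.choose k * (1 / 2) ^ i) *
          g (s + ((i - k : ℕ) * a - k * b)) := by
  -- With equal probabilities the step is a mixture of a fair choice between the two shifts and the
  -- identity. The binomial theorem for commuting operators is used twice: for this mixture and, in
  -- `h2`, for the fair choice.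
  have h1 : step a b w w =
      (2 * w) • ((1 / 2 : ℝ) • (shift (-b) + shift a)) + (1 - 2 * w) • 1 := by
    ext g s
    simp only [step_apply, LinearMap.add_apply, LinearMap.smul_apply, Pi.add_apply, Pi.smul_apply,
      shift_apply, smul_eq_mul, Module.End.one_apply]
    ring_nf
  have h2 : ∀ i : ℕ, (((1 / 2 : ℝ) • (shift (-b) + shift a)) ^ i) g s =
      ∑ k ∈ Finset.range (i + 1), (i.choose k * (1 / 2) ^ i) *
          g (s + ((i - k : ℕ) * a - k * b)) := by
    intro i
    rw [smul_pow, (shift_commute (-b) a).add_pow]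
    simp only [LinearMap.smul_apply, LinearMap.sum_apply, Pi.smul_apply, Finset.sum_apply,
      smul_eq_mul, Finset.mul_sum, shift_pow, shift_mul]
    refine Finset.sum_congr rfl fun k _ => ?_
    rw [← nsmul_eq_mul', LinearMap.smul_apply, Pi.smul_apply, shift_apply, nsmul_eq_mul]
    ring_nf
  generalize (1 / 2 : ℝ) • (shift (-b) + shift a) = H at h1 h2
  rw [h1, Commute.add_pow (Commute.smul_right (Commute.one_right _) _)]
  simp only [LinearMap.sum_apply, Finset.sum_apply]
  refine Finset.sum_congr rfl fun i _ => ?_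
  rw [← nsmul_eq_mul', LinearMap.smul_apply, Pi.smul_apply, smul_pow, smul_pow, one_pow,
    Algebra.mul_smul_comm, mul_one, LinearMap.smul_apply, LinearMap.smul_apply, Pi.smul_apply,
    Pi.smul_apply, h2, nsmul_eq_mul, smul_eq_mul, smul_eq_mul]
  ring

/-! ### An exchangeability argument -/

/-- A bounded weight on label vectors that is invariant under exchanging the label of a fixed
position with another one whenever both labels are nonzero. -/
lemma sum_mul_le_of_swap_invariant {n : ℕ} (i₀ : Fin n) {z π : Fin 3 → ℝ} (hz : z 0 = 0)
    (hπ : ∀ l, 0 ≤ π l) {c : (Fin n → Fin 3) → ℝ} (hc0 : ∀ ℓ, 0 ≤ c ℓ)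
    (hc1 : ∀ ℓ, c ℓ ≤ ∏ j, π (ℓ j))
    (hc : ∀ ℓ j, ℓ i₀ ≠ 0 → ℓ j ≠ 0 → c (ℓ ∘ Equiv.swap i₀ j) = c ℓ) :
    ∑ ℓ, z (ℓ i₀) * c ℓ ≤
      (n : ℝ)⁻¹ * ∑ ℓ : Fin n → Fin 3, (∏ j, π (ℓ j)) * max 0 (∑ j, z (ℓ j)) := by
  classical
  -- `e` indicates nonzero labels and `N` counts them, so `e (ℓ j) / N ℓ` is the uniform weight on
  -- the positions with nonzero label.
  set e : Fin 3 → ℝ := fun l => if l = 0 then 0 else 1 with he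
  have he0 : ∀ l, 0 ≤ e l := fun l => by simp only [he]; split_ifs <;> norm_num
  have hez : ∀ l, e l * z l = z l := fun l => by
    by_cases hl : l = 0 <;> simp [he, hl, hz]
  set N : (Fin n → Fin 3) → ℝ := fun ℓ => ∑ j, e (ℓ j) with hN
  have hN0 : ∀ ℓ, 0 ≤ N ℓ := fun ℓ => Finset.sum_nonneg fun j _ => he0 _
  have hNpos : ∀ ℓ j, e (ℓ j) ≠ 0 → N ℓ ≠ 0 := fun ℓ j hj => by
    have := Finset.single_le_sum (fun i _ => he0 (ℓ i)) (Finset.mem_univ j)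
    have := (he0 (ℓ j)).lt_of_ne' hj
    exact (by linarith : 0 < N ℓ).ne'
  have hcomp : ∀ (σ : Equiv.Perm (Fin n)) (f : Fin 3 → ℝ) (ℓ : Fin n → Fin 3),
      ∑ j, f ((ℓ ∘ σ) j) = ∑ j, f (ℓ j) := fun σ f ℓ => Equiv.sum_comp σ fun j => f (ℓ j)
  have hcompP : ∀ (σ : Equiv.Perm (Fin n)) (f : Fin 3 → ℝ) (ℓ : Fin n → Fin 3),
      ∏ j, f ((ℓ ∘ σ) j) = ∏ j, f (ℓ j) := fun σ f ℓ => Equiv.prod_comp σ fun j => f (ℓ j)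
  have hre : ∀ (σ : Equiv.Perm (Fin n)) (G : (Fin n → Fin 3) → ℝ),
      ∑ ℓ, G (ℓ ∘ σ) = ∑ ℓ, G ℓ := fun σ G =>
    (Equiv.arrowCongr σ.symm (Equiv.refl (Fin 3))).sum_comp G
  calc ∑ ℓ, z (ℓ i₀) * c ℓ
      = ∑ ℓ, ∑ j, e (ℓ i₀) * e (ℓ j) * z (ℓ i₀) * (c ℓ / N ℓ) := by
        refine Finset.sum_congr rfl fun ℓ _ => ?_
        have : ∑ j, e (ℓ i₀) * e (ℓ j) * z (ℓ i₀) * (c ℓ / N ℓ) =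
            e (ℓ i₀) * z (ℓ i₀) * (c ℓ / N ℓ) * N ℓ := by
          rw [hN, Finset.mul_sum]
          exact Finset.sum_congr rfl fun j _ => by ring
        rw [this, hez]
        by_cases h : ℓ i₀ = 0
        · simp [h, hz]
        · have := hNpos ℓ i₀ (by simp [he, h])
          field_simp
    _ = ∑ j, ∑ ℓ, e (ℓ i₀) * e (ℓ j) * z (ℓ i₀) * (c ℓ / N ℓ) := Finset.sum_comm
    -- Reindexing `ℓ` by the swap of `i₀` and `j` moves `z` to position `j`; `c` is invariant
    -- wherever the factor `e (ℓ i₀) * e (ℓ j)` does not vanish.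
    _ = ∑ j, ∑ ℓ, e (ℓ i₀) * e (ℓ j) * z (ℓ j) * (c ℓ / N ℓ) := by
        refine Finset.sum_congr rfl fun j _ => ?_
        rw [← hre (Equiv.swap i₀ j)]
        refine Finset.sum_congr rfl fun ℓ _ => ?_
        have hNs : N (ℓ ∘ Equiv.swap i₀ j) = N ℓ := hcomp _ e ℓ
        simp only [hNs, Function.comp_apply, Equiv.swap_apply_left, Equiv.swap_apply_right]
        by_cases h1 : ℓ i₀ = 0
        · simp [h1, he]
        by_cases h2 : ℓ j = 0
        · simp [h2, he]
        have := hc ℓ j h1 h2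
        simp only [Function.comp_def] at this
        simp only [Function.comp_def, this]
        ring
    _ = ∑ ℓ, e (ℓ i₀) * (c ℓ / N ℓ) * ∑ j, z (ℓ j) := by
        rw [Finset.sum_comm]
        refine Finset.sum_congr rfl fun ℓ _ => ?_
        rw [Finset.mul_sum]
        exact Finset.sum_congr rfl fun j _ => by rw [mul_assoc _ (e _), hez]; ring
    _ ≤ ∑ ℓ, e (ℓ i₀) * ((∏ j, π (ℓ j)) * max 0 (∑ j, z (ℓ j)) / N ℓ) := by
        refine Finset.sum_le_sum fun ℓ _ => ?_
        rw [mul_assoc, div_mul_eq_mul_div]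
        refine mul_le_mul_of_nonneg_left (div_le_div_of_nonneg_right ?_ (hN0 ℓ)) (he0 _)
        exact (mul_le_mul_of_nonneg_left (le_max_right _ _) (hc0 ℓ)).trans
          (mul_le_mul_of_nonneg_right (hc1 ℓ) (le_max_left _ _))
    -- All factors but `e (ℓ i₀)` are now invariant under permutations of the positions, so `i₀` may
    -- be replaced by an average over all `j`.
    _ = (n : ℝ)⁻¹ * ∑ j, ∑ ℓ : Fin n → Fin 3,
          e (ℓ j) * ((∏ j, π (ℓ j)) * max 0 (∑ j, z (ℓ j)) / N ℓ) := by
        have hn : (n : ℝ) ≠ 0 := by exact_mod_cast i₀.pos.ne'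
        rw [eq_inv_mul_iff_mul_eq₀ hn]
        have : ∀ j, ∑ ℓ : Fin n → Fin 3, e (ℓ j) * ((∏ j, π (ℓ j)) * max 0 (∑ j, z (ℓ j)) / N ℓ) =
            ∑ ℓ : Fin n → Fin 3, e (ℓ i₀) * ((∏ j, π (ℓ j)) * max 0 (∑ j, z (ℓ j)) / N ℓ) := by
          intro j
          rw [← hre (Equiv.swap i₀ j)]
          refine Finset.sum_congr rfl fun ℓ _ => ?_
          rw [hcomp _ z ℓ, hcompP _ π ℓ, show N (ℓ ∘ Equiv.swap i₀ j) = N ℓ from hcomp _ e ℓ]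
          simp
        rw [Finset.sum_congr rfl fun j _ => this j]
        simp
    _ ≤ (n : ℝ)⁻¹ * ∑ ℓ : Fin n → Fin 3, (∏ j, π (ℓ j)) * max 0 (∑ j, z (ℓ j)) := by
        refine mul_le_mul_of_nonneg_left ?_ (by positivity)
        rw [Finset.sum_comm]
        refine Finset.sum_le_sum fun ℓ _ => ?_
        rw [← Finset.sum_mul]
        have h0 : 0 ≤ (∏ j, π (ℓ j)) * max 0 (∑ j, z (ℓ j)) :=
          mul_nonneg (Finset.prod_nonneg fun j _ => hπ _) (le_max_left _ _)
        change N ℓ * _ ≤ _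
        rcases eq_or_ne (N ℓ) 0 with h | h
        · simpa [h] using h0
        · rw [mul_div_cancel₀ _ h]

/-- The bound of `sum_mul_le_of_swap_invariant` in terms of the random walk with step probabilities
`w`, `w`, whose drift dominates. -/
lemma sum_mul_le_drift {n : ℕ} (i₀ : Fin (n + 1)) {a b p q w : ℝ} {z π : Fin 3 → ℝ}
    (hz : z = ![0, a, -b]) (hπ : π = ![1 - p - q, p, q]) (hp0 : 0 ≤ p) (hq0 : 0 ≤ q)
    (hp : p ≤ w) (hq : q ≤ w) (hw : w + w ≤ 1) (h : (w - p) * a = (w - q) * b)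
    {c : (Fin (n + 1) → Fin 3) → ℝ} (hc0 : ∀ ℓ, 0 ≤ c ℓ) (hc1 : ∀ ℓ, c ℓ ≤ ∏ j, π (ℓ j))
    (hc : ∀ ℓ j, ℓ i₀ ≠ 0 → ℓ j ≠ 0 → c (ℓ ∘ Equiv.swap i₀ j) = c ℓ) :
    ∑ ℓ, z (ℓ i₀) * c ℓ ≤
      drift a b w w ((step a b w w ^ n) fun s => if 0 ≤ s then 1 else 0) 0 := by
  have hπ0 : ∀ l, 0 ≤ π l := by
    intro l
    fin_cases l <;> simp [hπ] <;> linarith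
  refine (sum_mul_le_of_swap_invariant i₀ (by simp [hz]) hπ0 hc0 hc1 hc).trans ?_
  have hs := sum_prod_eq_step_pow hz hπ (fun s => max 0 s) (n + 1) 0
  simp only [zero_add] at hs
  have hconv : ConvexOn ℝ univ fun s : ℝ => max 0 s :=
    (convexOn_const 0 convex_univ).sup (convexOn_id convex_univ)
  have hle := step_pow_le_step_pow hp0 hq0 hp hq hw h hconv (n + 1) 0
  -- This form lets `step_pow_id_mul` extract a factor `n + 1`, which cancels the averaging factor.
  have hmax : (fun s : ℝ => max 0 s) = fun s => s * if 0 ≤ s then 1 else 0 := by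
    ext s
    split_ifs with h
    · simp [h]
    · simp [le_of_not_ge h]
  rw [hs, inv_mul_le_iff₀ (by positivity)]
  rw [hmax] at hle ⊢
  rw [step_pow_id_mul a b w w] at hle
  exact_mod_cast hle

/-! ### The distribution functions `F_i` and the weights `w_i⁰` -/

lemma F_eq_sum (i : ℕ) (x : ℝ) :
    F i x = ∑ k ∈ Finset.range (i + 1), if (k : ℝ) ≤ x then (i.choose k * (1 / 2) ^ i : ℝ) else 0 := by
  rw [F, cdf_eq_real, map_measureReal_apply (by fun_prop) measurableSet_Iic, binomial_eq_sum_dirac,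
    measureReal_def, Measure.finsetSum_apply, ENNReal.toReal_sum (fun k _ => by
      rw [Measure.smul_apply, smul_eq_mul]
      exact ENNReal.mul_ne_top ENNReal.ofReal_ne_top (measure_ne_top _ _)),
    ← Nat.range_succ_eq_Iic]
  refine Finset.sum_congr rfl fun k hk => ?_
  have hki : k ≤ i := Nat.lt_succ_iff.1 (Finset.mem_range.1 hk)
  have hh : (half : ℝ) ^ k * (1 - half : ℝ) ^ (i - k) = (1 / 2) ^ i := by
    rw [show (half : ℝ) = 1 / 2 from rfl, show (1 - 1 / 2 : ℝ) = 1 / 2 by norm_num, ← pow_add,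
      Nat.add_sub_cancel' hki]
  rw [mul_assoc, hh, Measure.smul_apply, Measure.dirac_apply, smul_eq_mul, ENNReal.toReal_mul,
    ENNReal.toReal_ofReal (by positivity)]
  by_cases h : (k : ℝ) ≤ x <;> simp [h]

lemma F_nonneg (i : ℕ) (x : ℝ) : 0 ≤ F i x := cdf_nonneg _ _

lemma F_le_one (i : ℕ) (x : ℝ) : F i x ≤ 1 := cdf_le_one _ _

lemma F_mono (i : ℕ) : Monotone (F i) := monotone_cdf _

lemma F_floor (i : ℕ) (x : ℝ) : F i (⌊x⌋ : ℤ) = F i x := by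
  rw [F_eq_sum, F_eq_sum]
  refine Finset.sum_congr rfl fun k _ => ?_
  have : ((k : ℝ) ≤ (⌊x⌋ : ℤ)) ↔ (k : ℝ) ≤ x := by
    have := Int.le_floor (a := x) (z := (k : ℤ))
    exact_mod_cast this
  simp only [this]

lemma F_lt_of_lt {i m : ℕ} (hm : m ≤ i) {x y : ℝ} (hx : x < m) (hy : m ≤ y) : F i x < F i y := by
  rw [F_eq_sum, F_eq_sum]
  refine Finset.sum_lt_sum (fun k _ => ?_) ⟨m, Finset.mem_range.2 (by omega), ?_⟩
  · split_ifs with h1 h2 h2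
    · rfl
    · exact absurd (h1.trans (hx.le.trans hy)) h2
    · positivity
    · rfl
  · rw [if_neg hx.not_ge, if_pos hy]
    have := Nat.choose_pos hm
    positivity

lemma F_lt_one {i : ℕ} {x : ℝ} (hx : x < i) : F i x < 1 :=
  (F_lt_of_lt le_rfl hx le_rfl).trans_le (F_le_one i i)

lemma F_of_neg {i : ℕ} {x : ℝ} (hx : x < 0) : F i x = 0 := by
  rw [F_eq_sum]
  exact Finset.sum_eq_zero fun k _ => if_neg (hx.trans_le k.cast_nonneg).not_ge

/-- The argument of `F_i` in the definition of `α_i(t)`. -/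
lemma threshold_mem (i : ℕ) {t : ℝ} (ht : 0 ≤ t) :
    (i - (i + 1) / (t + 1) : ℝ) ∈ Ico (-1 : ℝ) i := by
  have h0 : (0 : ℝ) < (i + 1) / (t + 1) := by positivity
  have h1 : ((i : ℝ) + 1) / (t + 1) ≤ i + 1 := div_le_self (by positivity) (by linarith)
  constructor <;> linarith

/-- `F_i` is constant between integers and jumps at each of `0, …, i`, so its value at `x ∈ [-1, i)`
is first attained at `⌊x⌋`. If `⌊x⌋ = -1`, minimality is the constraint `k ≥ -1` itself. -/
lemma Finv_αi (i : ℕ) {t : ℝ} (ht : 0 ≤ t) :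
    Finv i (αi i t) = ⌊(i - (i + 1) / (t + 1) : ℝ)⌋ := by
  obtain ⟨h1, h2⟩ := threshold_mem i ht
  rw [Finv, αi]
  set x : ℝ := i - (i + 1) / (t + 1) with hx
  refine IsLeast.csInf_eq ⟨⟨Int.le_floor.2 (by simpa using h1), (F_floor i x).ge⟩, ?_⟩
  rintro k ⟨hk, hkx⟩
  by_contra! hlt
  have h0 : 0 ≤ ⌊x⌋ := by omega
  obtain ⟨m, hm⟩ := Int.eq_ofNat_of_zero_le h0
  have hmx : (m : ℝ) ≤ x := by simpa using Int.le_floor.1 hm.ge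
  have hmi : m ≤ i := by exact_mod_cast hmx.trans h2.le
  have hkm : (k : ℝ) < m := by
    have : k < (m : ℤ) := by omega
    exact_mod_cast this
  exact absurd (F_lt_of_lt hmi hkm hmx) hkx.not_gt

lemma F_Finv_αi_add_one (i : ℕ) {t : ℝ} (ht : 0 ≤ t) :
    F i ((Finv i (αi i t) : ℝ) + 1) = F i (i - (i + 1) / (t + 1) + 1) := by
  rw [Finv_αi i ht, ← F_floor i (i - (i + 1) / (t + 1) + 1), Int.floor_add_one]
  push_cast
  rfl

lemma αi_nonneg (i : ℕ) (t : ℝ) : 0 ≤ αi i t := F_nonneg _ _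

lemma αi_lt_one (i : ℕ) {t : ℝ} (ht : 0 ≤ t) : αi i t < 1 := F_lt_one (threshold_mem i ht).2

lemma αi_mono (i : ℕ) {s t : ℝ} (hs : 0 ≤ s) (h : s ≤ t) : αi i s ≤ αi i t :=
  F_mono i (by gcongr)

lemma αi_zero (i : ℕ) : αi i 0 = 0 := F_of_neg (by norm_num)

lemma finite_range_αi (i : ℕ) : (αi i '' Ici 0).Finite := by
  refine ((Set.finite_Icc (-1 : ℤ) i).image fun k : ℤ => F i k).subset ?_
  rintro _ ⟨t, ht, rfl⟩
  obtain ⟨h1, h2⟩ := threshold_mem i ht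
  refine ⟨⌊(i - (i + 1) / (t + 1) : ℝ)⌋, ⟨Int.le_floor.2 (by simpa using h1), ?_⟩, F_floor _ _⟩
  exact Int.floor_le_iff.2 (by push_cast; linarith)

lemma two_w (ε₀ : ℝ≥0) : (cloneProb ε₀ : ℝ) = 2 * w ε₀ := by
  rw [cloneProb, w]
  ring

lemma w_pos (ε₀ : ℝ≥0) : 0 < w ε₀ := by
  rw [w]
  positivity

lemma two_w_le_one (ε₀ : ℝ≥0) : 2 * w ε₀ ≤ 1 := two_w ε₀ ▸ (cloneProb ε₀).2.2

lemma w₀_eq (n : ℕ) (ε₀ : ℝ≥0) (i : ℕ) :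
    w₀ n ε₀ i = (n - 1).choose i * (2 * w ε₀) ^ i * (1 - 2 * w ε₀) ^ (n - 1 - i) := by
  rw [w₀, binomial_real_singleton, two_w]

lemma w₀_nonneg (n : ℕ) (ε₀ : ℝ≥0) (i : ℕ) : 0 ≤ w₀ n ε₀ i := measureReal_nonneg

lemma sum_w₀ {n : ℕ} (hn : 1 ≤ n) (ε₀ : ℝ≥0) : ∑ i ∈ Finset.range n, w₀ n ε₀ i = 1 := by
  obtain ⟨m, rfl⟩ := Nat.exists_eq_add_of_le' hn
  have h := add_pow (2 * w ε₀) (1 - 2 * w ε₀) m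
  rw [add_sub_cancel, one_pow] at h
  rw [h]
  refine Finset.sum_congr rfl fun i _ => ?_
  rw [w₀_eq, Nat.add_sub_cancel]
  ring

/-! ### Knots and ordinates -/

variable {n : ℕ} {ε₀ : ℝ≥0}

lemma knot_nonneg (t : ℝ) : 0 ≤ knot n ε₀ t :=
  Finset.sum_nonneg fun i _ => mul_nonneg (w₀_nonneg n ε₀ i) (αi_nonneg i t)

lemma knot_lt_one (hn : 1 ≤ n) {t : ℝ} (ht : 0 ≤ t) : knot n ε₀ t < 1 := by
  rw [← sum_w₀ hn ε₀, knot]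
  have hle : ∀ i ∈ Finset.range n, w₀ n ε₀ i * αi i t ≤ w₀ n ε₀ i := fun i _ =>
    mul_le_of_le_one_right (w₀_nonneg n ε₀ i) (αi_lt_one i ht).le
  refine (Finset.sum_le_sum hle).lt_of_ne fun h => ?_
  rw [Finset.sum_eq_sum_iff_of_le hle] at h
  have h0 : ∀ i ∈ Finset.range n, w₀ n ε₀ i = 0 := fun i hi => by
    by_contra hne
    exact (αi_lt_one i ht).ne (mul_eq_left₀ hne |>.1 (h i hi))
  have := sum_w₀ hn ε₀
  rw [Finset.sum_eq_zero h0] at this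
  exact zero_ne_one this

lemma knot_zero : knot n ε₀ 0 = 0 := by simp [knot, αi_zero]

lemma finite_knots : (knots n ε₀).Finite := by
  refine Set.Finite.insert _ ?_
  have h : (Set.pi univ fun i : Fin n => αi (i : ℕ) '' Ici 0).Finite :=
    Set.Finite.pi fun i => finite_range_αi (i : ℕ)
  refine (h.image fun v : Fin n → ℝ => ∑ i : Fin n, w₀ n ε₀ i * v i).subset ?_
  rintro _ ⟨t, ht, rfl⟩
  exact ⟨fun i => αi i t, fun i _ => ⟨t, ht, rfl⟩, by
    rw [knot, Finset.sum_range fun i => w₀ n ε₀ i * αi i t]⟩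

/-- Each `αi` is monotone, so equal weighted sums have equal terms: for every `i` either the weight
vanishes or `αi i s = αi i t`. Hence the arbitrary choice of `t` in `ordinate` does not matter. -/
lemma knotValue_eq_of_le {s t : ℝ} (hs : 0 ≤ s) (hst : s ≤ t)
    (h : knot n ε₀ s = knot n ε₀ t) : knotValue n ε₀ s = knotValue n ε₀ t := by
  have h' := (Finset.sum_eq_sum_iff_of_le fun i _ =>
    mul_le_mul_of_nonneg_left (αi_mono i hs hst) (w₀_nonneg n ε₀ i)).1 h
  rw [knotValue, knotValue, h]
  congr 2
  refine Finset.sum_congr rfl fun i hi => ?_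
  rcases mul_eq_mul_left_iff.1 (h' i hi) with h0 | h0 <;> simp [h0]

lemma knotValue_congr {s t : ℝ} (hs : 0 ≤ s) (ht : 0 ≤ t)
    (h : knot n ε₀ s = knot n ε₀ t) : knotValue n ε₀ s = knotValue n ε₀ t := by
  rcases le_total s t with hst | hst
  · exact knotValue_eq_of_le hs hst h
  · exact (knotValue_eq_of_le ht hst h.symm).symm

lemma ordinate_knot {t : ℝ} (ht : 0 ≤ t) : ordinate n ε₀ (knot n ε₀ t) = knotValue n ε₀ t := by
  have h : ∃ s, 0 ≤ s ∧ knot n ε₀ s = knot n ε₀ t := ⟨t, ht, rfl⟩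
  rw [ordinate, dif_pos h]
  exact knotValue_congr h.choose_spec.1 ht h.choose_spec.2

lemma ordinate_one (hn : 1 ≤ n) : ordinate n ε₀ 1 = 0 := by
  rw [ordinate, dif_neg]
  rintro ⟨t, ht, h⟩
  exact (knot_lt_one hn ht).ne h

lemma knotValue_mem (hn : 1 ≤ n) {t : ℝ} (ht : 0 ≤ t) : knotValue n ε₀ t ∈ Icc (0 : ℝ) 1 := by
  have hw := w_pos ε₀
  have hw2 := two_w_le_one ε₀
  have h1 : IdTradeOff (knot n ε₀ t) ∈ Icc (0 : ℝ) 1 := by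
    have := knot_nonneg (n := n) (ε₀ := ε₀) t
    have := knot_lt_one (ε₀ := ε₀) hn ht
    rw [IdTradeOff]
    constructor <;> linarith
  have h2 : ∑ i ∈ Finset.range n, w₀ n ε₀ i * (1 - F i ((Finv i (αi i t) : ℝ) + 1)) ∈
      Icc (0 : ℝ) 1 := by
    constructor
    · exact Finset.sum_nonneg fun i _ => mul_nonneg (w₀_nonneg n ε₀ i)
        (by linarith [F_le_one i ((Finv i (αi i t) : ℝ) + 1)])
    · refine (Finset.sum_le_sum fun i _ => ?_).trans_eq (sum_w₀ hn ε₀)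
      exact mul_le_of_le_one_right (w₀_nonneg n ε₀ i)
        (by linarith [F_nonneg i ((Finv i (αi i t) : ℝ) + 1)])
  rw [knotValue]
  constructor
  · have := mul_nonneg hw.le h1.1
    have := mul_nonneg (sub_nonneg.2 hw2) h2.1
    linarith
  · have := mul_le_of_le_one_right hw.le h1.2
    have := mul_le_of_le_one_right (sub_nonneg.2 hw2) h2.2
    linarith

lemma ordinate_nonneg (hn : 1 ≤ n) (a : ℝ) : 0 ≤ ordinate n ε₀ a := by
  rw [ordinate]
  split_ifs with h
  · exact (knotValue_mem hn h.choose_spec.1).1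
  · rfl

lemma knots_subset (hn : 1 ≤ n) : knots n ε₀ ⊆ Icc 0 1 := by
  rintro _ (rfl | ⟨t, ht, rfl⟩)
  · simp
  · exact ⟨knot_nonneg t, (knot_lt_one hn ht).le⟩

lemma zero_mem_knots : (0 : ℝ) ∈ knots n ε₀ := Or.inr ⟨0, self_mem_Ici, knot_zero⟩

lemma one_mem_knots : (1 : ℝ) ∈ knots n ε₀ := Or.inl rfl

/-! ### Piecewise linear interpolation -/

lemma interpolate_of_mem {K : Set ℝ} {v : ℝ → ℝ} {x : ℝ} (hx : x ∈ K) :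
    interpolate K v x = v x := by
  have h : sSup (K ∩ Iic x) = x := IsGreatest.csSup_eq ⟨⟨hx, mem_Iic.2 le_rfl⟩, fun y hy => hy.2⟩
  simp [interpolate, h]

lemma sSup_mem_le {K : Set ℝ} (hK : K.Finite) (h0 : 0 ∈ K) {x : ℝ} (hx : 0 ≤ x) :
    sSup (K ∩ Iic x) ∈ K ∩ Iic x :=
  Set.Nonempty.csSup_mem ⟨0, h0, hx⟩ (hK.inter_of_left _)

lemma sInf_mem_ge {K : Set ℝ} (hK : K.Finite) (h1 : 1 ∈ K) {x : ℝ} (hx : x ≤ 1) :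
    sInf (K ∩ Ici x) ∈ K ∩ Ici x :=
  Set.Nonempty.csInf_mem ⟨1, h1, hx⟩ (hK.inter_of_left _)

lemma interpolate_nonneg {K : Set ℝ} {v : ℝ → ℝ} (hK : K.Finite) (h0 : 0 ∈ K) (h1 : 1 ∈ K)
    (hv : ∀ a, 0 ≤ v a) {x : ℝ} (hx : x ∈ Icc (0 : ℝ) 1) : 0 ≤ interpolate K v x := by
  have ha := (sSup_mem_le hK h0 hx.1).2
  have hb := (sInf_mem_ge hK h1 hx.2).2
  simp only [interpolate]
  set a := sSup (K ∩ Iic x)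
  set b := sInf (K ∩ Ici x)
  simp only [mem_Iic, mem_Ici] at ha hb
  have hθ0 : 0 ≤ (x - a) / (b - a) := div_nonneg (by linarith) (by linarith)
  -- At a knot `a = b`; the quotient is then `0 / 0 = 0`, and the bounds persist.
  have hθ1 : (x - a) / (b - a) ≤ 1 := div_le_one_of_le₀ (by linarith) (by linarith)
  have := mul_nonneg hθ0 (hv b)
  have := mul_nonneg (sub_nonneg.2 hθ1) (hv a)
  linarith

lemma isPiecewiseLinear_interpolate {K : Set ℝ} (v : ℝ → ℝ) (hK : K.Finite) (hsub : K ⊆ Icc 0 1)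
    (h0 : 0 ∈ K) (h1 : 1 ∈ K) : IsPiecewiseLinear (interpolate K v) K := by
  refine ⟨hK, hsub, h0, h1, fun a ha b hb hab hdisj => ?_⟩
  have hno : ∀ y ∈ K, y ≤ a ∨ b ≤ y := fun y hy => by
    by_contra! h
    exact Set.disjoint_left.1 hdisj hy h
  obtain ⟨hpK, hpa⟩ := sSup_mem_le hK h0 ha.1
  obtain ⟨hqK, hqb⟩ := sInf_mem_ge hK h1 hb.2
  set p := sSup (K ∩ Iic a) with hp
  set q := sInf (K ∩ Ici b) with hq
  simp only [mem_Iic, mem_Ici] at hpa hqb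
  have hpq : q - p ≠ 0 := by
    have : p < q := by linarith
    exact (sub_pos.2 this).ne'
  -- One chord, between the knots `p ≤ a` and `q ≥ b`, serves all of `[a, b]`. Knots in `[a, b]` can
  -- only be end points and need separate treatment, since there the interpolation degenerates.
  have key : ∀ x ∈ Icc a b, interpolate K v x = v p + (x - p) / (q - p) * (v q - v p) := by
    intro x hx
    by_cases hxK : x ∈ K
    · rw [interpolate_of_mem hxK]
      rcases hno x hxK with h | h
      · obtain rfl : x = a := le_antisymm h hx.1
        have : p = x := IsGreatest.csSup_eq ⟨⟨hxK, mem_Iic.2 le_rfl⟩, fun y hy => hy.2⟩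
        simp [this]
      · obtain rfl : x = b := le_antisymm hx.2 h
        have : q = x := IsLeast.csInf_eq ⟨⟨hxK, mem_Ici.2 le_rfl⟩, fun y hy => hy.2⟩
        rw [← this, div_self hpq]
        ring
    · have e1 : K ∩ Iic x = K ∩ Iic a := by
        ext y
        refine and_congr_right fun hy => ⟨fun hyx => (hno y hy).resolve_right fun hby => ?_,
          fun hya => hya.trans hx.1⟩
        have : y = x := le_antisymm hyx (hx.2.trans hby)
        exact hxK (this ▸ hy)
      have e2 : K ∩ Ici x = K ∩ Ici b := by
        ext y
        refine and_congr_right fun hy => ⟨fun hyx => (hno y hy).resolve_left fun hya => ?_,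
          fun hyb => hx.2.trans hyb⟩
        have : y = x := le_antisymm (hya.trans hx.1) hyx
        exact hxK (this ▸ hy)
      simp only [interpolate, e1, e2]
      rfl
  intro x hx
  rw [key x hx, key a (left_mem_Icc.2 hab.le), key b (right_mem_Icc.2 hab.le)]
  have : b - a ≠ 0 := (sub_pos.2 hab).ne'
  field_simp
  ring

lemma fShuffle_knot {t : ℝ} (ht : 0 ≤ t) : fShuffle n ε₀ (knot n ε₀ t) = knotValue n ε₀ t := by
  rw [fShuffle, interpolate_of_mem (Or.inr ⟨t, ht, rfl⟩), ordinate_knot ht]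

lemma fShuffle_one (hn : 1 ≤ n) : fShuffle n ε₀ 1 = 0 := by
  rw [fShuffle, interpolate_of_mem one_mem_knots, ordinate_one hn]

lemma fShuffle_nonneg (hn : 1 ≤ n) {x : ℝ} (hx : x ∈ Icc (0 : ℝ) 1) : 0 ≤ fShuffle n ε₀ x :=
  interpolate_nonneg finite_knots zero_mem_knots one_mem_knots (ordinate_nonneg hn) hx

/-! ### The value of `f_Shuffle` at a knot as a drift -/

/-- Puts the value at a knot in the shape of a drift; for the clone step sizes, `1 - 2 w = w a` and
`lam - 2 w = w b`. -/
lemma one_sub_knotValue (hn : 1 ≤ n) {t : ℝ} (ht : 0 ≤ t) (lam : ℝ) :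
    1 - (knotValue n ε₀ t + lam * knot n ε₀ t) =
      ∑ i ∈ Finset.range n, w₀ n ε₀ i *
        ((1 - 2 * w ε₀) * F i (i - (i + 1) / (t + 1) + 1) -
          (lam - 2 * w ε₀) * F i (i - (i + 1) / (t + 1))) := by
  have e : ∀ i, F i (i - (i + 1) / (t + 1)) = αi i t := fun i => rfl
  simp only [knotValue, F_Finv_αi_add_one _ ht, e, mul_sub, Finset.sum_sub_distrib, mul_one,
    sum_w₀ hn ε₀, mul_left_comm (w₀ n ε₀ _), ← Finset.mul_sum, IdTradeOff]
  rw [show ∑ i ∈ Finset.range n, w₀ n ε₀ i * αi i t = knot n ε₀ t from rfl]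
  ring

/-- With `i` nonzero steps, `k` of them down, an extra step `-b` leaves the walk nonnegative iff `k
(a + b) ≤ i a - b`, that is `k ≤ i - (i + 1) / (t + 1)` with `t = a / b`. An extra step `a` instead
raises this threshold by exactly one. -/
lemma drift_step_pow_eq (hn : 1 ≤ n) {a b : ℝ} (ha : 0 < a) (hb : 0 < b) :
    drift a b (w ε₀) (w ε₀) ((step a b (w ε₀) (w ε₀) ^ (n - 1)) fun s => if 0 ≤ s then 1 else 0) 0 =
      ∑ i ∈ Finset.range n, w₀ n ε₀ i *
        (w ε₀ * a * F i (i - (i + 1) / (a / b + 1) + 1) -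
          w ε₀ * b * F i (i - (i + 1) / (a / b + 1))) := by
  have hr : n - 1 + 1 = n := Nat.sub_add_cancel hn
  rw [drift_apply, step_pow_apply_eq_sum, step_pow_apply_eq_sum, hr]
  simp only [← w₀_eq, mul_sub, Finset.sum_sub_distrib, Finset.mul_sum]
  have hx : ∀ i : ℕ, (i - (i + 1) / (a / b + 1) : ℝ) = i - (i + 1) * b / (a + b) := fun i => by
    have : a + b ≠ 0 := by positivity
    field_simp
  simp only [hx, F_eq_sum, Finset.mul_sum]
  congr 1
  · refine Finset.sum_congr rfl fun i _ => Finset.sum_congr rfl fun k hk => ?_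
    have hki : k ≤ i := Nat.lt_succ_iff.1 (Finset.mem_range.1 hk)
    have : (0 ≤ 0 + a + ((i - k : ℕ) * a - k * b)) ↔
        (k : ℝ) ≤ i - (i + 1) * b / (a + b) + 1 := by
      rw [Nat.cast_sub hki, sub_add_eq_add_sub, le_sub_comm, div_le_iff₀ (by positivity)]
      constructor <;> intro h <;> linarith
    simp only [this]
    split_ifs <;> ring
  · refine Finset.sum_congr rfl fun i _ => Finset.sum_congr rfl fun k hk => ?_
    have hki : k ≤ i := Nat.lt_succ_iff.1 (Finset.mem_range.1 hk)
    have : (0 ≤ 0 - b + ((i - k : ℕ) * a - k * b)) ↔ (k : ℝ) ≤ i - (i + 1) * b / (a + b) := by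
      rw [Nat.cast_sub hki, le_sub_comm, div_le_iff₀ (by positivity)]
      constructor <;> intro h <;> linarith
    simp only [this]
    split_ifs <;> ring

/-! ### Product measures -/

section Pi

variable {ι S : Type*} [Fintype ι] [MeasurableSpace S]

/-- Multilinear expansion of a product of sums of measures. -/
lemma pi_sum [DecidableEq ι] {L : Type*} [Fintype L] [DecidableEq L] (M : ι → L → Measure S)
    [∀ i l, IsFiniteMeasure (M i l)] :
    Measure.pi (fun i => ∑ l, M i l) = ∑ ℓ : ι → L, Measure.pi fun i => M i (ℓ i) := by
  refine Measure.pi_eq fun s _ => ?_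
  simp only [Measure.finsetSum_apply, Measure.pi_pi]
  rw [Finset.prod_univ_sum, Fintype.piFinset_univ]

omit [Fintype ι] in
lemma isFiniteMeasure_update [DecidableEq ι] {R : ι → Measure S} [∀ i, IsFiniteMeasure (R i)] (i : ι)
    (ν : Measure S) [IsFiniteMeasure ν] (j : ι) : IsFiniteMeasure (Function.update R i ν j) := by
  rcases eq_or_ne j i with rfl | h
  · simpa
  · rw [Function.update_of_ne h]
    infer_instance

lemma prod_update_apply [DecidableEq ι] (R : ι → Measure S) (i : ι) (ν : Measure S) (s : ι → Set S) :
    ∏ j, Function.update R i ν j (s j) = ν (s i) * ∏ j ∈ Finset.univ \ {i}, R j (s j) := by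
  simp only [Function.apply_update (fun j (μ : Measure S) => μ (s j)) R i ν]
  exact Finset.prod_update_of_mem (Finset.mem_univ i) _ _

/-- Linearity in a single coordinate carries an identity between measures of one record over to the
product measures. -/
lemma pi_update_add [DecidableEq ι] (R : ι → Measure S) [∀ i, IsFiniteMeasure (R i)]
    (i : ι) (μ ν : Measure S)
    [IsFiniteMeasure μ] [IsFiniteMeasure ν] :
    Measure.pi (Function.update R i (μ + ν)) =
      Measure.pi (Function.update R i μ) + Measure.pi (Function.update R i ν) := by
  have := isFiniteMeasure_update (R := R) i μ
  have := isFiniteMeasure_update (R := R) i ν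
  have := isFiniteMeasure_update (R := R) i (μ + ν)
  refine Measure.pi_eq fun s _ => ?_
  simp only [Measure.add_apply, Measure.pi_pi, prod_update_apply, add_mul]

lemma pi_update_smul [DecidableEq ι] (R : ι → Measure S) [∀ i, IsFiniteMeasure (R i)]
    (i : ι) (c : ℝ≥0)
    (ν : Measure S) [IsFiniteMeasure ν] :
    Measure.pi (Function.update R i (c • ν)) = c • Measure.pi (Function.update R i ν) := by
  have := isFiniteMeasure_update (R := R) i ν
  have := isFiniteMeasure_update (R := R) i (c • ν)
  refine Measure.pi_eq fun s _ => ?_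
  simp only [Measure.smul_apply, Measure.pi_pi, prod_update_apply, smul_mul_assoc]

lemma map_comp_perm_pi (μ : ι → Measure S) [∀ i, IsFiniteMeasure (μ i)] (σ : Equiv.Perm ι) :
    (Measure.pi μ).map (fun y => y ∘ σ) = Measure.pi (fun i => μ (σ i)) := by
  have hm : Measurable fun y : ι → S => y ∘ σ :=
    measurable_pi_lambda _ fun i => measurable_pi_apply (σ i)
  refine (Measure.pi_eq fun s hs => ?_).symm
  rw [Measure.map_apply hm (MeasurableSet.univ_pi hs)]
  have : (fun y : ι → S => y ∘ σ) ⁻¹' Set.pi univ s = Set.pi univ fun i => s (σ.symm i) := by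
    ext y
    simp only [mem_preimage, mem_univ_pi, Function.comp_apply]
    exact ⟨fun h i => by simpa using h (σ.symm i), fun h i => by simpa using h (σ i)⟩
  rw [this, Measure.pi_pi, ← Equiv.prod_comp σ]
  simp

lemma integral_pi_comp_perm (μ : ι → Measure S) [∀ i, IsFiniteMeasure (μ i)] (σ : Equiv.Perm ι)
    {φ : (ι → S) → ℝ} (hφ : Measurable φ) (hσ : ∀ y, φ (y ∘ σ) = φ y) :
    ∫ y, φ y ∂Measure.pi (fun i => μ (σ i)) = ∫ y, φ y ∂Measure.pi μ := by
  have hm : Measurable fun y : ι → S => y ∘ σ :=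
    measurable_pi_lambda _ fun i => measurable_pi_apply (σ i)
  rw [← map_comp_perm_pi, integral_map hm.aemeasurable hφ.aestronglyMeasurable]
  simp only [hσ]

end Pi

lemma integrable_of_mem_Icc {S : Type*} [MeasurableSpace S] {φ : S → ℝ} (hφ : Measurable φ)
    (h01 : ∀ s, φ s ∈ Icc (0 : ℝ) 1) (μ : Measure S) [IsFiniteMeasure μ] : Integrable φ μ :=
  Integrable.of_mem_Icc 0 1 hφ.aemeasurable (.of_forall h01)

/-! ### Clones: the decomposition of two distributions -/

section Clones

variable {S : Type*} [MeasurableSpace S]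

/-- Two distributions that are within a factor `e` of each other and of all `R` in a family differ
(after rescaling one of them by `lam`) by a signed measure whose positive and negative parts,
appropriately rescaled, are contained in every `R`. -/
lemma exists_clone_decomposition (P₀ P₁ : Measure S) [IsProbabilityMeasure P₀]
    [IsProbabilityMeasure P₁] {e lam : ℝ} (he : 1 < e) (hlam : 1 ≤ lam)
    (h₀₁ : ∀ E, MeasurableSet E → P₀.real E ≤ e * P₁.real E)
    (h₁₀ : ∀ E, MeasurableSet E → P₁.real E ≤ e * P₀.real E) :
    ∃ κp κm : Measure S, IsFiniteMeasure κp ∧ IsFiniteMeasure κm ∧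
      (P₁ + (lam * (e + 1) - 2).toNNReal • κm = lam.toNNReal • P₀ + (e - 1).toNNReal • κp) ∧
      (∀ R : Measure S, IsProbabilityMeasure R →
        (∀ E, MeasurableSet E → P₀.real E ≤ e * R.real E) →
        (∀ E, MeasurableSet E → P₁.real E ≤ e * R.real E) → κp + κm ≤ R) ∧
      κp.real univ ≤ 1 / (1 + e) ∧ κm.real univ ≤ 1 / (1 + e) ∧
      (1 / (1 + e) - κp.real univ) * (e - 1) =
        (1 / (1 + e) - κm.real univ) * (lam * (e + 1) - 2) := by
  have ha : 0 < e - 1 := by linarith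
  have hb : 0 < lam * (e + 1) - 2 := by nlinarith
  set a := e - 1 with ha_def
  set b := lam * (e + 1) - 2 with hb_def
  have hlam0 : 0 ≤ lam := by linarith
  -- `τp` and `τm` will be the positive and negative parts of `P₁ - lam P₀`; dividing them by `a`
  -- and `b` gives the clones.
  obtain ⟨A, hA, hAp, hAm⟩ := hahn_decomposition P₁ (lam.toNNReal • P₀)
  have hreal : ∀ E, (lam.toNNReal • P₀).real E = lam * P₀.real E := fun E => by
    rw [measureReal_nnreal_smul_apply, Real.coe_toNNReal _ hlam0]
  have hle1 : (lam.toNNReal • P₀).restrict A ≤ P₁.restrict A := Measure.le_iff.2 fun E hE => by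
    rw [Measure.restrict_apply hE, Measure.restrict_apply hE]
    exact hAp _ (hE.inter hA) inter_subset_right
  have hle2 : P₁.restrict Aᶜ ≤ (lam.toNNReal • P₀).restrict Aᶜ := Measure.le_iff.2 fun E hE => by
    rw [Measure.restrict_apply hE, Measure.restrict_apply hE]
    exact hAm _ (hE.inter hA.compl) inter_subset_right
  set τp := P₁.restrict A - (lam.toNNReal • P₀).restrict A
  set τm := (lam.toNNReal • P₀).restrict Aᶜ - P₁.restrict Aᶜ
  have hτp : ∀ E, MeasurableSet E → τp.real E = P₁.real (E ∩ A) - lam * P₀.real (E ∩ A) := by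
    intro E hE
    have h := congrArg (fun μ : Measure S => μ.real E) (Measure.sub_add_cancel_of_le hle1)
    rw [measureReal_add_apply, measureReal_restrict_apply hE, measureReal_restrict_apply hE,
      hreal] at h
    linarith
  have hτm : ∀ E, MeasurableSet E → τm.real E = lam * P₀.real (E ∩ Aᶜ) - P₁.real (E ∩ Aᶜ) := by
    intro E hE
    have h := congrArg (fun μ : Measure S => μ.real E) (Measure.sub_add_cancel_of_le hle2)
    rw [measureReal_add_apply, measureReal_restrict_apply hE, measureReal_restrict_apply hE,
      hreal] at h
    linarith
  have hκp : ∀ E, (a⁻¹.toNNReal • τp).real E = a⁻¹ * τp.real E := fun E => by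
    rw [measureReal_nnreal_smul_apply, Real.coe_toNNReal _ (by positivity)]
  have hκm : ∀ E, (b⁻¹.toNNReal • τm).real E = b⁻¹ * τm.real E := fun E => by
    rw [measureReal_nnreal_smul_apply, Real.coe_toNNReal _ (by positivity)]
  have hsplit : ∀ (μ : Measure S) [IsFiniteMeasure μ] (E : Set S),
      μ.real E = μ.real (E ∩ A) + μ.real (E ∩ Aᶜ) := fun μ _ E => by
    rw [← Set.sdiff_eq, measureReal_inter_add_sdiff hA]
  have hdec : ∀ E, MeasurableSet E →
      P₁.real E + τm.real E = lam * P₀.real E + τp.real E := fun E hE => by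
    rw [hτp E hE, hτm E hE, hsplit P₁ E, hsplit P₀ E]
    ring
  -- Adding `P₁(A) ≤ e P₀(A)` to `P₀(Aᶜ) ≤ e P₁(Aᶜ)` gives `(1 + e) (P₁(A) - P₀(A)) ≤ e - 1`.
  have hp : τp.real univ ≤ a / (1 + e) := by
    rw [hτp univ .univ, univ_inter, le_div_iff₀ (by linarith)]
    have h1 := h₁₀ A hA
    have h2 := h₀₁ Aᶜ hA.compl
    rw [probReal_compl_eq_one_sub hA, probReal_compl_eq_one_sub hA] at h2
    have h3 : (1 : ℝ) * P₀.real A ≤ lam * P₀.real A :=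
      mul_le_mul_of_nonneg_right hlam measureReal_nonneg
    nlinarith
  have hmean : τp.real univ - τm.real univ = 1 - lam := by
    have := hdec univ .univ
    simp only [probReal_univ] at this
    linarith
  -- `b` is chosen for this: masses `1 / (1 + e)` would give the same total `1 - lam`, so the
  -- deficits of the two clones balance, and the bound for `κm` follows from that for `κp`.
  have hw : a / (1 + e) - b / (1 + e) = 1 - lam := by
    rw [ha_def, hb_def]
    field_simp
    ring
  refine ⟨a⁻¹.toNNReal • τp, b⁻¹.toNNReal • τm, inferInstance, inferInstance, ?_, ?_, ?_, ?_, ?_⟩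
  · ext E hE
    rw [← measureReal_eq_measureReal_iff, measureReal_add_apply, measureReal_add_apply]
    simp only [measureReal_nnreal_smul_apply, Real.coe_toNNReal _ hlam0,
      Real.coe_toNNReal _ ha.le, Real.coe_toNNReal _ hb.le, Real.coe_toNNReal _ (inv_pos.2 ha).le,
      Real.coe_toNNReal _ (inv_pos.2 hb).le]
    rw [mul_inv_cancel_left₀ ha.ne', mul_inv_cancel_left₀ hb.ne']
    exact hdec E hE
  · intro R hR h₀ h₁
    refine Measure.le_iff.2 fun E hE => ?_
    rw [← ENNReal.toReal_le_toReal (measure_ne_top _ _) (measure_ne_top _ _), ← measureReal_def,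
      ← measureReal_def, measureReal_add_apply, hκp, hκm, hsplit R E, hτp E hE,
      hτm E hE]
    refine add_le_add ?_ ?_
    · rw [inv_mul_le_iff₀ ha]
      have hEA := hE.inter hA
      have h1 := h₁ _ hEA
      have h2 := h₁₀ _ hEA
      have h3 : e * (P₁.real (E ∩ A) - lam * P₀.real (E ∩ A)) ≤ (e - lam) * P₁.real (E ∩ A) := by
        nlinarith
      have h4 : (e - lam) * P₁.real (E ∩ A) ≤ a * (e * R.real (E ∩ A)) := by
        have hP0 : 0 ≤ P₁.real (E ∩ A) := measureReal_nonneg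
        calc (e - lam) * P₁.real (E ∩ A) ≤ a * P₁.real (E ∩ A) :=
              mul_le_mul_of_nonneg_right (by linarith) hP0
          _ ≤ _ := mul_le_mul_of_nonneg_left h1 ha.le
      have he0 : 0 < e := by linarith
      refine le_of_mul_le_mul_left ?_ he0
      linarith
    · rw [inv_mul_le_iff₀ hb]
      have hEA := hE.inter hA.compl
      have h0 := h₀ _ hEA
      have h2 := h₀₁ _ hEA
      have hR0 : 0 ≤ R.real (E ∩ Aᶜ) := measureReal_nonneg
      have he0 : 0 < e := by linarith
      have h3 : e * (lam * P₀.real (E ∩ Aᶜ) - P₁.real (E ∩ Aᶜ)) ≤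
          (lam * e - 1) * P₀.real (E ∩ Aᶜ) := by nlinarith
      have h4 : (lam * e - 1) * P₀.real (E ∩ Aᶜ) ≤ (lam * e - 1) * (e * R.real (E ∩ Aᶜ)) :=
        mul_le_mul_of_nonneg_left h0 (by nlinarith)
      -- `lam * e - 1 ≤ b` is equivalent to `1 ≤ lam`.
      have h5 : (lam * e - 1) * (e * R.real (E ∩ Aᶜ)) ≤ b * (e * R.real (E ∩ Aᶜ)) :=
        mul_le_mul_of_nonneg_right (by rw [hb_def]; linarith) (by positivity)
      refine le_of_mul_le_mul_left ?_ he0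
      linarith
  · rw [hκp, inv_mul_le_iff₀ ha]
    linarith [mul_one_div a (1 + e)]
  · rw [hκm, inv_mul_le_iff₀ hb]
    linarith [mul_one_div b (1 + e)]
  · rw [hκp, hκm, sub_mul, sub_mul, one_div_mul_eq_div, one_div_mul_eq_div, mul_comm a⁻¹,
      mul_comm b⁻¹, inv_mul_cancel_right₀ ha.ne', inv_mul_cancel_right₀ hb.ne']
    linarith

lemma forall_fin_three {p : Fin 3 → Prop} (h0 : p 0) (h1 : p 1) (h2 : p 2) : ∀ l, p l := by
  intro l
  fin_cases l
  exacts [h0, h1, h2]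

/-- The advantage of a symmetric test in distinguishing the data with the clones `κp`, `κm` is
bounded by the drift of a lazy random walk. -/
lemma integral_sub_le_drift {m : ℕ} (R : Fin (m + 1) → Measure S)
    [∀ j, IsProbabilityMeasure (R j)] (i₀ : Fin (m + 1)) (P₀ P₁ κp κm : Measure S)
    [IsProbabilityMeasure P₀] [IsProbabilityMeasure P₁] [IsFiniteMeasure κp] [IsFiniteMeasure κm]
    {a b lam : ℝ≥0} {w : ℝ} (hdec : P₁ + b • κm = lam • P₀ + a • κp)
    (hκ : ∀ j, κp + κm ≤ R j) (hp : κp.real univ ≤ w) (hm : κm.real univ ≤ w) (hw : w + w ≤ 1)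
    (h : (w - κp.real univ) * a = (w - κm.real univ) * b)
    {φ : (Fin (m + 1) → S) → ℝ} (hφ : Measurable φ) (h01 : ∀ y, φ y ∈ Icc (0 : ℝ) 1)
    (hsymm : ∀ (σ : Equiv.Perm (Fin (m + 1))) y, φ (y ∘ σ) = φ y) :
    ∫ y, φ y ∂Measure.pi (Function.update R i₀ P₁) -
        lam * ∫ y, φ y ∂Measure.pi (Function.update R i₀ P₀) ≤
      drift a b w w ((step a b w w ^ m) fun s => if 0 ≤ s then 1 else 0) 0 := by
  have hfin : ∀ (ν : Measure S) [IsFiniteMeasure ν],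
      IsFiniteMeasure (Measure.pi (Function.update R i₀ ν)) := fun ν _ => by
    have := isFiniteMeasure_update (R := R) i₀ ν
    infer_instance
  have := hfin P₀
  have := hfin P₁
  have := hfin κp
  have := hfin κm
  have hint : ∀ μ : Measure (Fin (m + 1) → S), IsFiniteMeasure μ → Integrable φ μ := fun μ _ =>
    integrable_of_mem_Icc hφ h01 μ
  have hlin : ∫ y, φ y ∂Measure.pi (Function.update R i₀ P₁) -
        lam * ∫ y, φ y ∂Measure.pi (Function.update R i₀ P₀) =
      a * ∫ y, φ y ∂Measure.pi (Function.update R i₀ κp) -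
        b * ∫ y, φ y ∂Measure.pi (Function.update R i₀ κm) := by
    have h := congrArg (fun ν => ∫ y, φ y ∂Measure.pi (Function.update R i₀ ν)) hdec
    simp only [pi_update_add, pi_update_smul] at h
    rw [integral_add_measure (hint _ inferInstance) (hint _ inferInstance),
      integral_add_measure (hint _ inferInstance) (hint _ inferInstance),
      integral_smul_nnreal_measure, integral_smul_nnreal_measure, integral_smul_nnreal_measure,
      NNReal.smul_def, NNReal.smul_def, NNReal.smul_def, smul_eq_mul, smul_eq_mul,
      smul_eq_mul] at h
    linarith
  -- Only the remainder, label `0`, depends on the record; the clones are common to all records.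
  obtain ⟨M, hM0, hM1, hM2⟩ : ∃ M : Fin (m + 1) → Fin 3 → Measure S,
      (∀ j, M j 0 = R j - (κp + κm)) ∧ (∀ j, M j 1 = κp) ∧ ∀ j, M j 2 = κm :=
    ⟨fun j => ![R j - (κp + κm), κp, κm], fun _ => rfl, fun _ => rfl, fun _ => rfl⟩
  have hMfin : ∀ j l, IsFiniteMeasure (M j l) := fun j => forall_fin_three
    (by rw [hM0]; infer_instance) (by rw [hM1]; infer_instance) (by rw [hM2]; infer_instance)
  have hMsum : ∀ j, ∑ l, M j l = R j := fun j => by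
    rw [Fin.sum_univ_three, hM0, hM1, hM2, add_assoc]
    exact Measure.sub_add_cancel_of_le (hκ j)
  set c : (Fin (m + 1) → Fin 3) → ℝ := fun ℓ => ∫ y, φ y ∂Measure.pi fun j => M j (ℓ j) with hc
  have hexp : ∀ l₀, ∫ y, φ y ∂Measure.pi (Function.update R i₀ (M i₀ l₀)) =
      ∑ ℓ, if ℓ i₀ = l₀ then c ℓ else 0 := by
    intro l₀
    -- Suppressing every label but `l₀` at position `i₀` lets the multilinear expansion run over all
    -- label vectors.
    set M' : Fin (m + 1) → Fin 3 → Measure S :=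
      Function.update M i₀ fun l => if l = l₀ then M i₀ l₀ else 0 with hM'
    have hM'fin : ∀ j l, IsFiniteMeasure (M' j l) := by
      intro j l
      rcases eq_or_ne j i₀ with rfl | hj
      · simp only [hM', Function.update_self]
        split_ifs <;> infer_instance
      · simpa only [hM', Function.update_of_ne hj] using hMfin j l
    have hR : Function.update R i₀ (M i₀ l₀) = fun j => ∑ l, M' j l := by
      ext1 j
      rcases eq_or_ne j i₀ with rfl | hj
      · simp [hM']
      · simp [hM', hj, hMsum]
    rw [hR, pi_sum, integral_finsetSum_measure fun ℓ _ => hint _ inferInstance]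
    refine Finset.sum_congr rfl fun ℓ _ => ?_
    split_ifs with hl
    · rw [hc]
      congr 2
      ext1 j
      rcases eq_or_ne j i₀ with rfl | hj
      · simp [hM', hl]
      · simp [hM', hj]
    · have : (Measure.pi fun j => M' j (ℓ j)) = 0 := by
        rw [← Measure.measure_univ_eq_zero, Measure.pi_univ]
        exact Finset.prod_eq_zero (Finset.mem_univ i₀) (by simp [hM', hl])
      rw [this, integral_zero_measure]
  have hcsum : a * ∫ y, φ y ∂Measure.pi (Function.update R i₀ κp) -
        b * ∫ y, φ y ∂Measure.pi (Function.update R i₀ κm) =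
      ∑ ℓ, (![0, (a : ℝ), -(b : ℝ)] : Fin 3 → ℝ) (ℓ i₀) * c ℓ := by
    have h1 := hexp 1
    have h2 := hexp 2
    rw [hM1] at h1
    rw [hM2] at h2
    rw [h1, h2, Finset.mul_sum, Finset.mul_sum, ← Finset.sum_sub_distrib]
    refine Finset.sum_congr rfl fun ℓ _ => ?_
    generalize ℓ i₀ = l
    revert l
    exact forall_fin_three (by simp) (by simp) (by simp)
  rw [hlin, hcsum]
  refine sum_mul_le_drift (n := m) i₀ (p := κp.real univ) (q := κm.real univ) rfl rfl
    measureReal_nonneg measureReal_nonneg hp hm hw h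
    (fun ℓ => integral_nonneg fun y => (h01 y).1) (fun ℓ => ?_) (fun ℓ j h0 hj => ?_)
  · have hmass : ∀ j l, (M j l).real univ =
        (![1 - κp.real univ - κm.real univ, κp.real univ, κm.real univ] : Fin 3 → ℝ) l := by
      refine fun j => forall_fin_three ?_ (by rw [hM1]; rfl) (by rw [hM2]; rfl)
      have := congrArg (fun μ : Measure S => μ.real univ) (hMsum j)
      simp only [Fin.sum_univ_three, probReal_univ] at this
      rw [measureReal_add_apply, measureReal_add_apply, hM1, hM2] at this
      rw [Matrix.cons_val_zero]
      linarith
    calc c ℓ ≤ ∫ _, (1 : ℝ) ∂Measure.pi fun j => M j (ℓ j) :=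
          integral_mono (hint _ inferInstance) (integrable_const 1) fun y => (h01 y).2
      _ = ∏ j, (M j (ℓ j)).real univ := by
          simp [measureReal_def, Measure.pi_univ, ENNReal.toReal_prod]
      _ = _ := Finset.prod_congr rfl fun j _ => hmass j _
  -- Exchanging two clone labels has the same effect as exchanging the two records, which a
  -- symmetric test cannot see.
  · have hswap : (fun k => M k ((ℓ ∘ Equiv.swap i₀ j) k)) =
        fun k => M (Equiv.swap i₀ j k) (ℓ (Equiv.swap i₀ j k)) := by
      have hne : ∀ k k' l, l ≠ 0 → M k l = M k' l := fun k k' => forall_fin_three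
        (fun h => absurd rfl h) (fun _ => by rw [hM1, hM1]) (fun _ => by rw [hM2, hM2])
      ext1 k
      rcases eq_or_ne k i₀ with rfl | hk
      · simpa using hne _ _ _ hj
      rcases eq_or_ne k j with rfl | hkj
      · simpa using hne _ _ _ h0
      simp [Equiv.swap_apply_of_ne_of_ne hk hkj]
    simp only [hc]
    rw [hswap]
    exact integral_pi_comp_perm (fun k => M k (ℓ k)) (Equiv.swap i₀ j) hφ (hsymm _)

end Clones

variable {Z W : Type*} [MeasurableSpace W] {n : ℕ} {ε₀ : ℝ≥0}

/-! ### Tests on the output of the shuffler -/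

/-- The average of a function of `n` variables over all permutations of its arguments. -/
noncomputable def permAverage (φ : (Fin n → W) → ℝ) (y : Fin n → W) : ℝ :=
  (Fintype.card (Equiv.Perm (Fin n)) : ℝ)⁻¹ * ∑ π : Equiv.Perm (Fin n), φ (y ∘ π)

omit [MeasurableSpace W] in
lemma permAverage_comp_perm (φ : (Fin n → W) → ℝ) (σ : Equiv.Perm (Fin n)) (y : Fin n → W) :
    permAverage φ (y ∘ σ) = permAverage φ y := by
  rw [permAverage, permAverage, ← Equiv.sum_comp (Equiv.mulLeft σ) fun π => φ (y ∘ π)]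
  rfl

omit [MeasurableSpace W] in
lemma permAverage_mem {φ : (Fin n → W) → ℝ} (h01 : ∀ y, φ y ∈ Icc (0 : ℝ) 1) (y : Fin n → W) :
    permAverage φ y ∈ Icc (0 : ℝ) 1 := by
  have hc : (0 : ℝ) < Fintype.card (Equiv.Perm (Fin n)) := by exact_mod_cast Fintype.card_pos
  constructor
  · exact mul_nonneg (inv_nonneg.2 hc.le) (Finset.sum_nonneg fun π _ => (h01 _).1)
  · rw [permAverage, inv_mul_le_iff₀ hc, mul_one]
    calc ∑ π : Equiv.Perm (Fin n), φ (y ∘ π) ≤ ∑ _π : Equiv.Perm (Fin n), (1 : ℝ) :=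
          Finset.sum_le_sum fun π _ => (h01 (y ∘ π)).2
      _ = _ := by simp

lemma measurable_comp_perm (π : Equiv.Perm (Fin n)) : Measurable fun y : Fin n → W => y ∘ π :=
  measurable_pi_lambda _ fun i => measurable_pi_apply (π i)

lemma measurable_permAverage {φ : (Fin n → W) → ℝ} (hφ : Measurable φ) :
    Measurable (permAverage φ) :=
  (Finset.measurable_fun_sum _ fun π _ => hφ.comp (measurable_comp_perm π)).const_mul _

lemma bind_shuffler (μ : Measure (Fin n → W)) :
    μ.bind (shuffler W n) = (Fintype.card (Equiv.Perm (Fin n)) : ℝ≥0∞)⁻¹ •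
      ∑ π : Equiv.Perm (Fin n), μ.map fun y => y ∘ π := by
  ext E hE
  rw [Measure.bind_apply hE (shuffler W n).aemeasurable, Measure.smul_apply,
    Measure.finsetSum_apply, smul_eq_mul]
  have h : ∀ y, shuffler W n y E = (Fintype.card (Equiv.Perm (Fin n)) : ℝ≥0∞)⁻¹ *
      ∑ π : Equiv.Perm (Fin n), ((fun y : Fin n → W => y ∘ π) ⁻¹' E).indicator 1 y := fun y => by
    simp only [shuffler, Kernel.coe_mk, Measure.smul_apply, Measure.finsetSum_apply, smul_eq_mul,
      Measure.dirac_apply' _ hE]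
    rfl
  have hm : ∀ π : Equiv.Perm (Fin n), MeasurableSet ((fun y : Fin n → W => y ∘ π) ⁻¹' E) :=
    fun π => measurable_comp_perm π hE
  simp only [h]
  rw [lintegral_const_mul _ (Finset.measurable_fun_sum _ fun π _ =>
      measurable_one.indicator (hm π)),
    lintegral_finsetSum _ fun π _ => measurable_one.indicator (hm π)]
  simp only [lintegral_indicator_one (hm _), Measure.map_apply (measurable_comp_perm _) hE]

/-- Averaging over permutations moves from the output to the test, so only symmetric tests on the
unshuffled product law have to be considered. -/
lemma integral_shuffledMechanism (A₀ : Z → ProbabilityMeasure W) (D : Fin n → Z)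
    {φ : (Fin n → W) → ℝ} (hφ : Measurable φ) (h01 : ∀ y, φ y ∈ Icc (0 : ℝ) 1) :
    ∫ y, φ y ∂(shuffledMechanism A₀ D : Measure (Fin n → W)) =
      ∫ y, permAverage φ y ∂Measure.pi fun i => (A₀ (D i) : Measure W) := by
  have h : (shuffledMechanism A₀ D : Measure (Fin n → W)) =
      (Measure.pi fun i => (A₀ (D i) : Measure W)).bind (shuffler W n) := rfl
  set μ := Measure.pi fun i => (A₀ (D i) : Measure W)
  have hm : ∀ π : Equiv.Perm (Fin n), IsProbabilityMeasure (μ.map fun y => y ∘ π) := fun π =>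
    Measure.isProbabilityMeasure_map (measurable_comp_perm π).aemeasurable
  rw [h, bind_shuffler, integral_smul_measure, integral_finsetSum_measure fun π _ =>
    integrable_of_mem_Icc hφ h01 _]
  simp only [permAverage]
  have hint : ∀ π ∈ Finset.univ, Integrable (fun y => φ (y ∘ (π : Equiv.Perm (Fin n)))) μ :=
    fun π _ => integrable_of_mem_Icc (hφ.comp (measurable_comp_perm π)) (fun y => h01 _) _
  rw [integral_const_mul, integral_finsetSum _ hint]
  simp [integral_map (measurable_comp_perm _).aemeasurable hφ.aestronglyMeasurable]

lemma IsLocalDP.real_le {A₀ : Z → ProbabilityMeasure W} (h : IsLocalDP A₀ ε₀) (z z' : Z)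
    {E : Set W} (hE : MeasurableSet E) :
    (A₀ z : Measure W).real E ≤ Real.exp ε₀ * (A₀ z' : Measure W).real E := by
  have := ENNReal.toReal_mono (ENNReal.mul_ne_top ENNReal.ofReal_ne_top (measure_ne_top _ _))
    (h z z' E hE)
  rwa [ENNReal.toReal_mul, ENNReal.toReal_ofReal (Real.exp_pos _).le] at this

/-- The linear lower bound on the error region of the shuffled mechanism. -/
lemma exists_knot_le {A₀ : Z → ProbabilityMeasure W} (hA₀ : IsLocalDP A₀ ε₀) (hn : 1 ≤ n)
    {D₀ D₁ : Fin n → Z} (hD : Neighboring D₀ D₁) {lam : ℝ} (hlam : 1 ≤ lam)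
    {φ : (Fin n → W) → ℝ} (hφ : Measurable φ) (h01 : ∀ y, φ y ∈ Icc (0 : ℝ) 1) :
    ∃ t, 0 ≤ t ∧ fShuffle n ε₀ (knot n ε₀ t) + lam * knot n ε₀ t ≤
      1 - ∫ y, φ y ∂(shuffledMechanism A₀ D₁ : Measure (Fin n → W)) +
        lam * ∫ y, φ y ∂(shuffledMechanism A₀ D₀ : Measure (Fin n → W)) := by
  have hlam0 : 0 ≤ lam := by linarith
  -- For `ε₀ = 0` the step size `e - 1` vanishes and the clones cannot be normalized; but then `A₀`
  -- is constant and the knot `0` suffices.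
  rcases eq_or_ne (ε₀ : ℝ) 0 with hε | hε
  · have hA : ∀ z z', A₀ z = A₀ z' := fun z z' => Subtype.ext <| Measure.ext fun E hE => by
      have h1 := hA₀ z z' E hE
      have h2 := hA₀ z' z E hE
      simp only [hε, Real.exp_zero, ENNReal.ofReal_one, one_mul] at h1 h2
      exact le_antisymm h1 h2
    have hM : shuffledMechanism A₀ D₀ = shuffledMechanism A₀ D₁ := Subtype.ext <| by
      change (Measure.pi fun i => (A₀ (D₀ i) : Measure W)).bind _ =
        (Measure.pi fun i => (A₀ (D₁ i) : Measure W)).bind _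
      rw [show (fun i => (A₀ (D₀ i) : Measure W)) = fun i => (A₀ (D₁ i) : Measure W) from
        funext fun i => by rw [hA (D₀ i) (D₁ i)]]
    refine ⟨0, le_rfl, ?_⟩
    rw [fShuffle_knot le_rfl, knot_zero, hM]
    have h1 := (knotValue_mem (ε₀ := ε₀) hn le_rfl).2
    have h2 : 0 ≤ ∫ y, φ y ∂(shuffledMechanism A₀ D₁ : Measure (Fin n → W)) :=
      integral_nonneg fun y => (h01 y).1
    nlinarith
  obtain ⟨i₀, hi₀⟩ := hD
  have he : 1 < Real.exp ε₀ := Real.one_lt_exp_iff.2 (ε₀.2.lt_of_ne' hε)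
  set e := Real.exp ε₀ with he_def
  have ha : 0 < e - 1 := by linarith
  have hb : 0 < lam * (e + 1) - 2 := by nlinarith
  obtain ⟨κp, κm, _, _, hdec, hκ, hp, hm, hmean⟩ := exists_clone_decomposition
    (A₀ (D₀ i₀) : Measure W) (A₀ (D₁ i₀)) he hlam (fun E hE => hA₀.real_le _ _ hE)
    (fun E hE => hA₀.real_le _ _ hE)
  obtain ⟨m, rfl⟩ := Nat.exists_eq_add_of_le' hn
  set R : Fin (m + 1) → Measure W := fun j => (A₀ (D₀ j) : Measure W)
  have hw : w ε₀ = 1 / (1 + e) := rfl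
  have key := integral_sub_le_drift R i₀ (A₀ (D₀ i₀) : Measure W) (A₀ (D₁ i₀)) κp κm hdec
    (fun j => hκ _ inferInstance (fun E hE => hA₀.real_le _ _ hE)
      (fun E hE => hA₀.real_le _ _ hE)) hp hm (by rw [← hw]; linarith [two_w_le_one ε₀])
    (by rwa [Real.coe_toNNReal _ ha.le, Real.coe_toNNReal _ hb.le])
    (measurable_permAverage hφ) (permAverage_mem h01) (permAverage_comp_perm φ)
  rw [Real.coe_toNNReal _ ha.le, Real.coe_toNNReal _ hb.le, Real.coe_toNNReal _ hlam0, ← hw] at key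
  have hR₀ : Function.update R i₀ (A₀ (D₀ i₀) : Measure W) =
      fun j => (A₀ (D₀ j) : Measure W) := Function.update_eq_self i₀ R
  have hR₁ : Function.update R i₀ (A₀ (D₁ i₀) : Measure W) =
      fun j => (A₀ (D₁ j) : Measure W) := by
    ext1 j
    rcases eq_or_ne j i₀ with rfl | hj
    · simp
    · simp [hj, R, hi₀ j hj]
  rw [hR₀, hR₁, ← integral_shuffledMechanism A₀ _ hφ h01,
    ← integral_shuffledMechanism A₀ _ hφ h01] at key
  -- The witness is `t = a / b`, the ratio of the step sizes of the walk.
  refine ⟨(e - 1) / (lam * (e + 1) - 2), by positivity, ?_⟩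
  rw [fShuffle_knot (by positivity)]
  have h1 := one_sub_knotValue (ε₀ := ε₀) hn
    (by positivity : 0 ≤ (e - 1) / (lam * (e + 1) - 2)) lam
  have h2 := drift_step_pow_eq (ε₀ := ε₀) hn ha hb
  have hwa : w ε₀ * (e - 1) = 1 - 2 * w ε₀ := by
    rw [hw]
    field_simp
    ring
  have hwb : w ε₀ * (lam * (e + 1) - 2) = lam - 2 * w ε₀ := by
    rw [hw]
    field_simp
    ring
  rw [hwa, hwb, ← h1, Nat.add_sub_cancel] at h2
  rw [h2] at key
  linarith

/-! ### Symmetrization -/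

lemma min_leftInv_nonneg (hn : 1 ≤ n) {x : ℝ} (hx : x ∈ Icc (0 : ℝ) 1) :
    0 ≤ min (fShuffle n ε₀ x) (leftInv (fShuffle n ε₀) x) :=
  le_min (fShuffle_nonneg hn hx) (Real.sInf_nonneg fun _ hy => hy.1.1)

/-- The real-valued supremum dominates its terms only when bounded above, which nonnegativity of `g`
ensures. -/
lemma le_conjOn_Icc {g : ℝ → ℝ} (hg : ∀ x ∈ Icc (0 : ℝ) 1, 0 ≤ g x) {x : ℝ}
    (hx : x ∈ Icc (0 : ℝ) 1) (y : ℝ) : x * y - g x ≤ conjOn (Icc 0 1) g y := by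
  refine le_ciSup (f := fun x : Icc (0 : ℝ) 1 => (x : ℝ) * y - g x) ⟨|y|, ?_⟩ ⟨x, hx⟩
  rintro _ ⟨⟨z, hz⟩, rfl⟩
  have h1 := hg z hz
  have h2 : z * y ≤ |y| := by
    rcases abs_cases y with ⟨h, h'⟩ | ⟨h, h'⟩ <;> rw [h] <;> nlinarith [hz.1, hz.2]
  simp only
  linarith

lemma leftInv_le {f : ℝ → ℝ} {x : ℝ} (hx : x ∈ Icc (0 : ℝ) 1) : leftInv f (f x) ≤ x :=
  csInf_le ⟨0, fun _ hy => hy.1.1⟩ ⟨hx, le_rfl⟩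

lemma Neighboring.symm {D₀ D₁ : Fin n → Z} (h : Neighboring D₀ D₁) : Neighboring D₁ D₀ :=
  h.imp fun _ hi j hj => (hi j hj).symm

lemma isFDP_symmetrization {A₀ : Z → ProbabilityMeasure W} (hA₀ : IsLocalDP A₀ ε₀) (hn : 1 ≤ n) :
    IsFDP (n := n) (shuffledMechanism A₀) (symmetrization (fShuffle n ε₀)) := by
  intro D₀ D₁ hD α hα
  refine le_csInf ⟨1, fun _ => 0, measurable_const, by simp, by simpa using hα.1, by simp⟩ ?_
  rintro β ⟨φ, hφ, h01, hle, rfl⟩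
  set p := ∫ y, φ y ∂(shuffledMechanism A₀ D₀ : Measure (Fin n → W)) with hp
  set q := ∫ y, φ y ∂(shuffledMechanism A₀ D₁ : Measure (Fin n → W)) with hq
  have hq1 : q ≤ 1 := by
    have := integral_mono (integrable_of_mem_Icc hφ h01 (shuffledMechanism A₀ D₁ : Measure _))
      (integrable_const 1) fun y => (h01 y).2
    simpa using this
  set g := fun x => min (fShuffle n ε₀ x) (leftInv (fShuffle n ε₀) x) with hg
  have hg0 : ∀ x ∈ Icc (0 : ℝ) 1, 0 ≤ g x := fun x hx => min_leftInv_nonneg hn hx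
  have hknot : ∀ {t : ℝ}, 0 ≤ t → knot n ε₀ t ∈ Icc (0 : ℝ) 1 := fun ht =>
    ⟨knot_nonneg _, (knot_lt_one hn ht).le⟩
  refine ciSup_le fun ⟨y, _⟩ => ?_
  simp only
  rcases le_or_gt 0 y with hy | hy
  · have h1 := le_conjOn_Icc hg0 (right_mem_Icc.2 zero_le_one) y
    have h2 : g 1 ≤ 0 := (min_le_left _ _).trans (fShuffle_one hn).le
    have h3 := mul_le_of_le_one_left hy hα.2
    linarith
  rcases le_or_gt y (-1) with hy1 | hy1
  · obtain ⟨t, ht, h⟩ := exists_knot_le hA₀ hn hD (lam := -y) (by linarith) hφ h01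
    rw [← hp, ← hq] at h
    have h1 := le_conjOn_Icc hg0 (hknot ht) y
    have h2 : g (knot n ε₀ t) ≤ _ := min_le_left _ _
    have h3 := mul_le_mul_of_nonneg_left hle (neg_nonneg.2 hy.le)
    linarith
  -- The complementary test has the two errors interchanged. Multiplying by `-y` makes the value at
  -- the knot the abscissa, where `leftInv` is at most the knot.
  · obtain ⟨t, ht, h⟩ := exists_knot_le hA₀ hn hD.symm (lam := (-y)⁻¹)
      ((one_le_inv₀ (by linarith)).2 (by linarith)) (φ := fun s => 1 - φ s)
      (measurable_const.sub hφ)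
      (fun s => ⟨sub_nonneg.2 (h01 s).2, by linarith [(h01 s).1]⟩)
    rw [integral_sub (integrable_const _) (integrable_of_mem_Icc hφ h01 _),
      integral_sub (integrable_const _) (integrable_of_mem_Icc hφ h01 _), ← hp, ← hq] at h
    simp only [integral_const, probReal_univ, smul_eq_mul, mul_one] at h
    have hf : fShuffle n ε₀ (knot n ε₀ t) ∈ Icc (0 : ℝ) 1 := by
      rw [fShuffle_knot ht]
      exact knotValue_mem hn ht
    have h1 := le_conjOn_Icc hg0 hf y
    have h2 : g (fShuffle n ε₀ (knot n ε₀ t)) ≤ knot n ε₀ t :=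
      (min_le_right _ _).trans (leftInv_le (hknot ht))
    have hy0 : 0 < -y := by linarith
    have h3 := mul_le_mul_of_nonneg_left h hy0.le
    rw [mul_add, mul_add, mul_inv_cancel_left₀ hy0.ne', mul_inv_cancel_left₀ hy0.ne'] at h3
    have h4 := mul_le_mul_of_nonneg_left hle hy0.le
    linarith

end ShuffleDP

theorem theorem1 {Z W : Type*} [MeasurableSpace W] (n : ℕ) (hn : 1 ≤ n) (ε₀ : ℝ≥0)
    (A₀ : Z → ProbabilityMeasure W) (hA₀ : ShuffleDP.IsLocalDP A₀ ε₀) :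
    -- the knots lie in `[0, 1]`
    (∀ t : ℝ, 0 ≤ t → ShuffleDP.knot n ε₀ t ∈ Icc (0 : ℝ) 1) ∧
    -- `f_Shuffle` is piecewise linear with these knots and has the prescribed values there
    ShuffleDP.IsPiecewiseLinear (ShuffleDP.fShuffle n ε₀) (ShuffleDP.knots n ε₀) ∧
    (∀ t : ℝ, 0 ≤ t →
      ShuffleDP.fShuffle n ε₀ (ShuffleDP.knot n ε₀ t) =
        2 * ShuffleDP.w ε₀ * ShuffleDP.IdTradeOff (ShuffleDP.knot n ε₀ t) +
          (1 - 2 * ShuffleDP.w ε₀) *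
            ∑ i ∈ Finset.range n, ShuffleDP.w₀ n ε₀ i *
              (1 - ShuffleDP.F i ((ShuffleDP.Finv i (ShuffleDP.αi i t) : ℝ) + 1))) ∧
    ShuffleDP.fShuffle n ε₀ 1 = 0 ∧
    -- the privacy guarantee
    ShuffleDP.IsFDP (n := n) (ShuffleDP.shuffledMechanism A₀)
      (ShuffleDP.symmetrization (ShuffleDP.fShuffle n ε₀)) := by
  open ShuffleDP in
  exact ⟨fun t ht => ⟨knot_nonneg t, (knot_lt_one hn ht).le⟩,
    isPiecewiseLinear_interpolate _ finite_knots (knots_subset hn) zero_mem_knots one_mem_knots,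
    fun t ht => fShuffle_knot ht, fShuffle_one hn, isFDP_symmetrization hA₀ hn⟩
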